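/- Let $d\ge 2$ be a squarefree integer, $K=\mathbb{Q}(\sqrt d)\subseteq\mathbb{R}$, and let $\mathcal{O}_K$ be its ring of integers. If $d\equiv 1\bmod 4$, put $\omega=\frac{1+\sqrt d}{2}$ and $\mathsf{d}_K=d$; otherwise put $\omega=\sqrt d$ and $\mathsf{d}_K=4d$. Let $\varepsilon>1$ be the fundamental unit of $\mathcal{O}_K$ (so $\mathcal{O}_K^\times=\{\pm\varepsilon^k:k\in\mathbb{Z}\}$), write $\varepsilon=x+y\omega$ with integers $x,y\ge 0$, and let $\mathrm{N}$ be the norm of $K/\mathbb{Q}$. For a positive integer $f$ let $\mathcal{O}_f=\mathbb{Z}+f\mathcal{O}_K$, and let $\mathrm{h}(d)=|\mathrm{Pic}(\mathcal{O}_K)|$. Let $\left(\frac{\cdot}{\cdot}\right)$ be the Kronecker symbol; a prime $p$ is ramified (respectively split) if $\left(\frac{\mathsf{d}_K}{p}\right)=0$ (respectively $=1$). A positive integer $f$ is an unusual conductor of $d$ if $f$ is squarefree, $f$ is divisible by a ramified prime, $f$ is not divisible by a split prime, $\mathrm{h}(d)=|\mathrm{Pic}(\mathcal{O}_f)|=2$,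 and $\left|pa^2-\frac{\mathsf{d}_K}{p}b^2\right|\ne 4$ for every ramified prime $p\mid f$ and all $a,b\in\mathbb{Z}$. Let $D_d$ be the set of unusual conductors of $d$. **Theorem 2.5.** Let $\mathrm{h}(d)=2$ and suppose that one of the following conditions is satisfied: (a) there are distinct primes $p,q$ with $p\equiv q\equiv 1\bmod 4$, $d=pq$ and $\mathrm{N}(\varepsilon)=-1$; (b) there are primes $p,q$ with $p\equiv 1\bmod 8$, $q\equiv 3\bmod 4$, $d=pq$ and $y$ odd; (c) there are distinct primes $p,q$ with $p\equiv q\equiv 3\bmod 8$ and $d=2pq$; (d) there are primes $p,q$ with $p\equiv 1\bmod 8$, $q\equiv 3\bmod 4$, $\left(\frac{p}{q}\right)=-1$ and $d=2pq$. Then $D_d=\emptyset$ if and only if $d\mid y$. -/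

import Mathlib

namespace RealQuadratic

/-- The field `K = ℚ(√d)`, as a subfield of the real numbers. -/
noncomputable abbrev quadField (d : ℕ) : IntermediateField ℚ ℝ :=
  IntermediateField.adjoin ℚ {Real.sqrt (d : ℝ)}

/-- The ring of algebraic integers of `K = ℚ(√d)`. -/
noncomputable abbrev maxOrder (d : ℕ) : Type :=
  NumberField.RingOfIntegers (quadField d)

/-- The real number represented by an algebraic integer of `K ⊆ ℝ`. -/
noncomputable def toReal {d : ℕ} (z : maxOrder d) : ℝ :=
  ((z : quadField d) : ℝ)

/-- `ω = (1 + √d) / 2` if `d ≡ 1 mod 4`, and `ω = √d` otherwise. -/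
noncomputable def omega (d : ℕ) : ℝ :=
  if d % 4 = 1 then (1 + Real.sqrt (d : ℝ)) / 2 else Real.sqrt (d : ℝ)

/-- The discriminant `d_K` of `ℚ(√d)` for squarefree `d`:
it is `d` if `d ≡ 1 mod 4`, and `4 d` otherwise. -/
def disc (d : ℕ) : ℤ :=
  if d % 4 = 1 then (d : ℤ) else 4 * (d : ℤ)

/-- The Kronecker symbol of `a` modulo a prime number `p`: for `p = 2` it is
`0` if `a` is even, `1` if `a ≡ ±1 mod 8` and `-1` if `a ≡ ±3 mod 8`;
for an odd prime `p` it is the Legendre symbol. (Only prime moduli are used.) -/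
def kronecker (a : ℤ) (p : ℕ) : ℤ :=
  if p = 2 then ZMod.χ₈ (a : ZMod 8) else jacobiSym a p

/-- The prime `p` is ramified in `ℚ(√d)`. -/
def IsRamified (d p : ℕ) : Prop :=
  p.Prime ∧ kronecker (disc d) p = 0

/-- The prime `p` is split in `ℚ(√d)`. -/
def IsSplit (d p : ℕ) : Prop :=
  p.Prime ∧ kronecker (disc d) p = 1

/-- The order `𝒪_f = ℤ + f 𝒪_K` of conductor `f`. -/
def order (d f : ℕ) : Subring (maxOrder d) where
  carrier := {z | ∃ (n : ℤ) (w : maxOrder d), z = (n : maxOrder d) + (f : maxOrder d) * w}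
  zero_mem' := ⟨0, 0, by simp⟩
  one_mem' := ⟨1, 0, by simp⟩
  add_mem' := by
    rintro _ _ ⟨m, v, rfl⟩ ⟨n, w, rfl⟩
    exact ⟨m + n, v + w, by push_cast; ring⟩
  neg_mem' := by
    rintro _ ⟨m, v, rfl⟩
    exact ⟨-m, -v, by push_cast; ring⟩
  mul_mem' := by
    rintro _ _ ⟨m, v, rfl⟩ ⟨n, w, rfl⟩
    exact ⟨m * n, (m : maxOrder d) * w + (n : maxOrder d) * v + (f : maxOrder d) * v * w, by
      push_cast; ring⟩

/-- The class number `h(d) = |Pic(𝒪_K)|`. -/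
noncomputable def classNumber (d : ℕ) : ℕ :=
  Nat.card (CommRing.Pic (maxOrder d))

/-- `|Pic(𝒪_f)|`. -/
noncomputable def orderClassNumber (d f : ℕ) : ℕ :=
  Nat.card (CommRing.Pic (order d f))

/-- `ε` is the fundamental unit of `𝒪_K` with `ε > 1`, that is, the unit group of `𝒪_K`
is `{± ε ^ k : k ∈ ℤ}` and `ε > 1`. -/
def IsFundamentalUnit {d : ℕ} (ε : (maxOrder d)ˣ) : Prop :=
  1 < toReal (ε : maxOrder d) ∧ ∀ u : (maxOrder d)ˣ, ∃ k : ℤ, u = ε ^ k ∨ u = -ε ^ k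

/-- The set `D_d` of unusual conductors of `d`. The division `disc d / p` is exact, because a
ramified prime divides the discriminant. -/
def unusualConductors (d : ℕ) : Set ℕ :=
  {f | 0 < f ∧ Squarefree f ∧
    (∃ p : ℕ, IsRamified d p ∧ p ∣ f) ∧
    (∀ p : ℕ, IsSplit d p → ¬ p ∣ f) ∧
    classNumber d = orderClassNumber d f ∧ orderClassNumber d f = 2 ∧
    ∀ p : ℕ, IsRamified d p → p ∣ f →
      ∀ a b : ℤ, |(p : ℤ) * a ^ 2 - disc d / (p : ℤ) * b ^ 2| ≠ 4}

end RealQuadratic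

/-! Write `δ = √d`. Everything turns on comparing `Pic(𝒪_f)` with `Pic(𝒪_K)` through extension of
ideals, which is surjective for every `f > 1` because each class contains the inverse of an ideal
coprime to `f` (`ClassGroup.extendedHom_surjective_of_conductor`).

Suppose `d ∤ y`. As `d` is squarefree, some prime `ℓ ∣ d` does not divide `y`. Modulo `ℓ` one has
`δ² = 0`, so the units modulo the nonzero integers form the group of all `1 + tδ`, cyclic of order
`ℓ`, and `ε` generates it (`exists_residue`). Hence extension from `𝒪_ℓ` is also injective and
`|Pic(𝒪_ℓ)| = 2`. It remains to show that `ℓ a² - (d_K/ℓ) b² = ±4` is unsolvable; then `ℓ` is an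
unusual conductor. In (a) and (b) a solution gives `α` with `α² = ℓ · unit`, hence a square root of
`ℓ` or of `ℓ ε`. The former is not in `K`; the latter contradicts `N(ε) = -1` in (a). In (b) the
prime above `2` is principal by a genus argument (`exists_sq_sub_mul_sq_eq_two`), so `2 ε` is a
square as well and `2ℓ` would be one. In (c) and (d) `y` is even, so `ℓ` is odd, and residue symbols
exclude a solution.

Suppose `d ∣ y`, and let a ramified `p` divide an unusual conductor `f`. If `p ∣ d`, all units lie
in `𝒪_p`; but equality of class numbers makes every element coprime to `f` associated to an element
of `𝒪_f`, and `1 + (f/p)δ` is a counterexample (`orderClassNumber_ne`). Otherwise `p = 2` and `d ≡ 3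
mod 4`, which is case (b), where the principal prime above `2` solves the forbidden equation. -/

open scoped nonZeroDivisors

/-! ### Integral representatives of ideal classes. -/

/-- An integral ideal that divides a nonzero principal ideal, as a unit of the monoid of
fractional ideals. -/
theorem FractionalIdeal.isUnit_coeIdeal_of_mul_eq {A : Type*} [CommRing A] [IsDomain A]
    {I J : Ideal A} {c : A} (hc : c ≠ 0) (h : I * J = Ideal.span {c}) :
    IsUnit (I : FractionalIdeal A⁰ (FractionRing A)) := by
  have hc' : algebraMap A (FractionRing A) c ≠ 0 := by simpa using hc
  refine IsUnit.of_mul_eq_one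
    ((J : FractionalIdeal A⁰ (FractionRing A)) * spanSingleton A⁰ (algebraMap A _ c)⁻¹) ?_
  rw [← mul_assoc, ← coeIdeal_mul, h, coeIdeal_span_singleton, spanSingleton_mul_spanSingleton,
    mul_inv_cancel₀ hc', spanSingleton_one]

/-- Every ideal class of a domain is represented by an integral ideal that divides a nonzero
principal ideal. -/
theorem ClassGroup.exists_integral_rep {A : Type*} [CommRing A] [IsDomain A] (x : ClassGroup A) :
    ∃ (I J : Ideal A) (c : A) (u : (FractionalIdeal A⁰ (FractionRing A))ˣ),
      c ≠ 0 ∧ I * J = Ideal.span {c} ∧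
        (u : FractionalIdeal A⁰ (FractionRing A)) = I ∧ ClassGroup.mk _ u = x := by
  have hnum (v : (FractionalIdeal A⁰ (FractionRing A))ˣ) :
      ((v : FractionalIdeal A⁰ (FractionRing A)).num : FractionalIdeal A⁰ (FractionRing A)) =
        FractionalIdeal.spanSingleton A⁰ (algebraMap A _
          ((v : FractionalIdeal A⁰ (FractionRing A)).den : A)) *
            (v : FractionalIdeal A⁰ (FractionRing A)) := by
    exact (FractionalIdeal.den_mul_self_eq_num' _ _ _).symm
  refine ClassGroup.induction (FractionRing A) (fun u => ?_) x
  · set I := (u : FractionalIdeal A⁰ (FractionRing A)).num with hI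
    have hIu : IsUnit (I : FractionalIdeal A⁰ (FractionRing A)) :=
      FractionalIdeal.isUnit_num.mpr u.isUnit
    obtain ⟨v, hv⟩ := hIu
    refine ⟨I, ((v⁻¹ : (FractionalIdeal A⁰ (FractionRing A))ˣ) :
        FractionalIdeal A⁰ (FractionRing A)).num,
      (((v⁻¹ : (FractionalIdeal A⁰ (FractionRing A))ˣ) :
        FractionalIdeal A⁰ (FractionRing A)).den : A), v,
      nonZeroDivisors.coe_ne_zero _, ?_, hv, ?_⟩
    · apply FractionalIdeal.coeIdeal_injective (K := FractionRing A)
      simp only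
      rw [FractionalIdeal.coeIdeal_mul, hnum v⁻¹, ← hv, mul_left_comm, Units.mul_inv, mul_one,
        FractionalIdeal.coeIdeal_span_singleton]
    · symm
      rw [ClassGroup.mk_eq_mk]
      refine ⟨Units.mk0 (algebraMap A (FractionRing A)
        ((u : FractionalIdeal A⁰ (FractionRing A)).den : A)) (by simp), ?_⟩
      ext1
      rw [Units.val_mul, coe_toPrincipalIdeal, hv, hI, hnum u, mul_comm]
      rfl

/-! ### Extension and contraction of ideal classes between a ring and a subring with conductor. -/

section Conductor

variable {B : Type*} [CommRing B] {A : Subring B} {m : B}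

/-- The extension to `B` of the contraction of an ideal coprime to the conductor. -/
theorem Ideal.map_comap_subring_of_isCoprime (hm : ∀ b, m * b ∈ A) {J : Ideal B}
    (hJ : J ⊔ Ideal.span {m} = ⊤) :
    (J.comap (algebraMap A B)).map (algebraMap A B) = J := by
  refine le_antisymm Ideal.map_comap_le fun t ht => ?_
  obtain ⟨b, hb, c, hc, h1⟩ := Submodule.mem_sup.mp ((Ideal.eq_top_iff_one _).mp hJ)
  obtain ⟨c, rfl⟩ := Ideal.mem_span_singleton'.mp hc
  have hbA : b ∈ A := by
    have : b = 1 - m * c := by rw [← h1]; ring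
    rw [this]; exact sub_mem (one_mem _) (hm c)
  have h2 : t = b * t + (m * t) * c := by
    calc t = t * (b + c * m) := by rw [h1, mul_one]
      _ = _ := by ring
  rw [h2]
  refine add_mem (Ideal.mul_mem_right _ _ ?_) (Ideal.mul_mem_right _ _ ?_)
  · exact Ideal.mem_map_of_mem (algebraMap A B) (I := J.comap (algebraMap A B)) (x := ⟨b, hbA⟩) hb
  · exact Ideal.mem_map_of_mem (algebraMap A B) (I := J.comap (algebraMap A B)) (x := ⟨m * t, hm t⟩)
      (J.mul_mem_left m ht)

/-- Contraction of ideals coprime to the conductor is multiplicative, and maps principal ideals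
generated by elements congruent to `1` to principal ideals. -/
theorem Ideal.comap_subring_mul_comap (hm : ∀ b, m * b ∈ A) {I J : Ideal B} {a : A} {r : B}
    (ha : (a : B) = 1 - m ^ 2 * r) (hIJ : I * J = Ideal.span {(a : B)}) :
    I.comap (algebraMap A B) * J.comap (algebraMap A B) = Ideal.span {a} := by
  have haI : (a : B) ∈ I := Ideal.mul_le_left (J := J) (hIJ ▸ Ideal.mem_span_singleton_self _)
  have haJ : (a : B) ∈ J := Ideal.mul_le_right (I := I) (hIJ ▸ Ideal.mem_span_singleton_self _)
  apply le_antisymm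
  · rw [Ideal.mul_le]
    intro x hx y hy
    have hxy : (x * y : B) ∈ Ideal.span {(a : B)} := hIJ ▸ Ideal.mul_mem_mul hx hy
    obtain ⟨z, hz⟩ := Ideal.mem_span_singleton'.mp hxy
    have hzA : z ∈ A := by
      have : z = x * y + m * (m * r * z) := by
        rw [← hz, ha]; ring
      rw [this]; exact add_mem (mul_mem x.2 y.2) (hm _)
    exact Ideal.mem_span_singleton'.mpr ⟨⟨z, hzA⟩, Subtype.ext hz⟩
  · rw [Ideal.span_singleton_le_iff_mem]
    -- Each factor needs its own `m` to land in the subring; this is why `a` is taken congruent to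
    -- `1` modulo `m ^ 2`.
    have key : ∀ t ∈ I * J, ∃ s ∈ I.comap (algebraMap A B) * J.comap (algebraMap A B),
        (s : B) = m ^ 2 * t := by
      intro t ht
      induction ht using Submodule.mul_induction_on' with
      | mem_mul_mem x hx y hy =>
        exact ⟨⟨m * x, hm x⟩ * ⟨m * y, hm y⟩, Ideal.mul_mem_mul (I.mul_mem_left m hx)
          (J.mul_mem_left m hy), by simp; ring⟩
      | add x _ y _ hx hy =>
        obtain ⟨s, hs, hs'⟩ := hx
        obtain ⟨u, hu, hu'⟩ := hy
        exact ⟨s + u, add_mem hs hu, by push_cast; rw [hs', hu']; ring⟩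
    obtain ⟨s, hs, hs'⟩ := key (r * a) (hIJ ▸ Ideal.mul_mem_left _ _
      (Ideal.mem_span_singleton_self _))
    have h2 : a = a * a + s := by
      apply Subtype.ext
      push_cast
      rw [hs', show m ^ 2 * (r * (a : B)) = (1 - (1 - m ^ 2 * r)) * a by ring, ← ha]
      ring
    rw [h2]
    exact add_mem (Ideal.mul_mem_mul haI haJ) hs

/-- Multiples of the conductor in an extended ideal come from the ideal itself. -/
theorem Ideal.exists_mem_of_mem_map_subring (hm : ∀ b, m * b ∈ A) {I : Ideal A} {t : B}
    (ht : t ∈ I.map (algebraMap A B)) : ∃ s ∈ I, (s : B) = m * t := by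
  suffices ∀ b, ∃ s ∈ I, (s : B) = m * b * t by simpa using this 1
  induction ht using Submodule.span_induction with
  | mem x hx =>
    intro b
    obtain ⟨y, hy, rfl⟩ := hx
    exact ⟨⟨m * b, hm b⟩ * y, I.mul_mem_left _ hy, rfl⟩
  | zero => exact fun b => ⟨0, zero_mem _, by simp⟩
  | add x y _ _ hx hy =>
    intro b
    obtain ⟨s, hs, hs'⟩ := hx b
    obtain ⟨u, hu, hu'⟩ := hy b
    exact ⟨s + u, add_mem hs hu, by push_cast; rw [hs', hu']; ring⟩
  | smul c x _ hx =>
    intro b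
    obtain ⟨s, hs, hs'⟩ := hx (b * c)
    exact ⟨s, hs, by rw [hs', smul_eq_mul]; ring⟩

/-- An ideal whose extension is principal contains a generator of its extension, provided that
the ring is `ℤ` modulo the conductor `ℓ` and units represent all residues outside `P`. -/
theorem Ideal.exists_mem_map_eq_span [IsDomain B] {ℓ : ℕ} [hℓ : Fact ℓ.Prime]
    (hm : ∀ b : B, (ℓ : B) * b ∈ A)
    {P : Ideal B} (hP : P ≠ ⊤) (hℓP : (ℓ : B) ∈ P)
    (hU : ∀ b ∉ P, ∃ (η : Bˣ) (c : ℤ) (w : B), b = c * η + ℓ * w)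
    {I : Ideal A} {β : B} (hβ : β ≠ 0) (hI : I.map (algebraMap A B) = Ideal.span {β}) :
    ∃ g ∈ I, Ideal.span {(g : B)} = Ideal.span {β} := by
  -- Otherwise the extension `βB` of `I` is contained in `βP`, which puts `1` in `P`.
  have h1 : ∃ g ∈ I, ∃ w ∉ P, (g : B) = β * w := by
    by_contra! hcon
    have : I.map (algebraMap A B) ≤ Ideal.span {β} * P := by
      rw [Ideal.map_le_iff_le_comap]
      intro g hg
      have hg' : (g : B) ∈ Ideal.span {β} := hI ▸ Ideal.mem_map_of_mem (algebraMap A B) hg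
      obtain ⟨w, hw⟩ := Ideal.mem_span_singleton.mp hg'
      refine Ideal.mem_span_singleton_mul.mpr ⟨w, ?_, hw.symm⟩
      by_contra hwP
      exact hcon g hg w hwP hw
    rw [hI, Ideal.span_singleton_le_iff_mem, Ideal.mem_span_singleton_mul] at this
    obtain ⟨z, hz, hz'⟩ := this
    refine hP ((Ideal.eq_top_iff_one _).mpr ?_)
    rwa [← mul_left_cancel₀ hβ (hz'.trans (mul_one β).symm)]
  obtain ⟨g, hg, w, hw, hgw⟩ := h1
  obtain ⟨η, c, v, rfl⟩ := hU w hw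
  have hc : ¬ (ℓ : ℤ) ∣ c := by
    rintro ⟨k, rfl⟩
    refine hw (add_mem ?_ (P.mul_mem_right _ hℓP))
    push_cast
    exact P.mul_mem_right _ (P.mul_mem_right _ hℓP)
  have hspan : Ideal.span {β * η} = Ideal.span {β} :=
    Ideal.span_singleton_mul_right_unit η.isUnit β
  -- Since `ℓβB` lies in `I`, both `cβη` and `ℓβη` belong to `I`; a Bézout relation between `ℓ` and
  -- `c` then gives `βη ∈ I`.
  have hmem : ∀ b, ∃ s ∈ I, (s : B) = ℓ * (β * b) := fun b =>
    Ideal.exists_mem_of_mem_map_subring hm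
      (hI ▸ Ideal.mul_mem_right b _ (Ideal.mem_span_singleton_self β))
  obtain ⟨s, hs, hs'⟩ := hmem v
  obtain ⟨u, hu, hu'⟩ := hmem η
  have hcop : IsCoprime (ℓ : ℤ) c :=
    (Nat.prime_iff_prime_int.mp hℓ.out).irreducible.coprime_iff_not_dvd.mpr hc
  obtain ⟨a, b, hab⟩ := hcop
  refine ⟨a * u + b * (g - s), add_mem (I.mul_mem_left _ hu)
    (I.mul_mem_left _ (sub_mem hg hs)), ?_⟩
  rw [← hspan]
  congr 2
  have hab' : (a : B) * ℓ + b * c = 1 := by exact_mod_cast congrArg (Int.cast : ℤ → B) hab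
  push_cast
  rw [hu', hs', hgw]
  linear_combination (β * η) * hab'

/-- Invertible ideals with principal extension are principal, under the same hypotheses. -/
theorem Ideal.eq_span_of_map_eq_span [IsDomain B] {ℓ : ℕ} [hℓ : Fact ℓ.Prime]
    (hm : ∀ b : B, (ℓ : B) * b ∈ A)
    (hA : ∀ a ∈ A, ∃ (n : ℤ) (b : B), a = n + ℓ * b)
    {P : Ideal B} (hP : P ≠ ⊤) (hℓP : (ℓ : B) ∈ P)
    (hU : ∀ b ∉ P, ∃ (η : Bˣ) (c : ℤ) (w : B), b = c * η + ℓ * w)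
    {I J : Ideal A} {c : A} (hc : c ≠ 0) (hIJ : I * J = Ideal.span {c}) {β : B}
    (hI : I.map (algebraMap A B) = Ideal.span {β}) :
    ∃ g : A, I = Ideal.span {g} := by
  have hc' : (c : B) ≠ 0 := by simpa using hc
  have hmul : I.map (algebraMap A B) * J.map (algebraMap A B) = Ideal.span {(c : B)} := by
    rw [← Ideal.map_mul, hIJ, Ideal.map_span, Set.image_singleton]; rfl
  have hβ : β ≠ 0 := by
    rintro rfl
    rw [hI, Ideal.span_singleton_eq_bot.mpr rfl, Ideal.bot_mul] at hmul
    exact hc' (Ideal.span_singleton_eq_bot.mp hmul.symm)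
  obtain ⟨g, hg, hgβ⟩ := Ideal.exists_mem_map_eq_span hm hP hℓP hU hβ hI
  rw [← hgβ] at hI
  have hg0 : (g : B) ≠ 0 := by
    intro h0
    rw [h0, Ideal.span_singleton_eq_bot.mpr rfl] at hgβ
    exact hβ (Ideal.span_singleton_eq_bot.mp hgβ.symm)
  rw [hI] at hmul
  have hcg : (c : B) ∈ Ideal.span {(g : B)} * J.map (algebraMap A B) :=
    hmul ▸ Ideal.mem_span_singleton_self _
  obtain ⟨γ, hγ, hγc⟩ := Ideal.mem_span_singleton_mul.mp hcg
  have hJ : J.map (algebraMap A B) = Ideal.span {γ} := by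
    rw [← hγc, ← Ideal.span_singleton_mul_span_singleton] at hmul
    exact (Ideal.span_singleton_mul_right_inj hg0).mp hmul
  have hγ0 : γ ≠ 0 := by rintro rfl; exact hc' (by rw [← hγc, mul_zero])
  -- With `c = gγ`, the aim is `γ ∈ J`: then `xγ ∈ IJ = gγA` forces `x ∈ gA` for every `x ∈ I`. So
  -- far only `h = γw ∈ J` is available, with `w ∈ A` a unit of `B`.
  obtain ⟨h, hh, hhγ⟩ := Ideal.exists_mem_map_eq_span hm hP hℓP hU hγ0 hJ
  obtain ⟨v, hv⟩ := Ideal.span_singleton_eq_span_singleton.mp hhγ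
  have hghc : g * h ∈ Ideal.span {c} := hIJ ▸ Ideal.mul_mem_mul hg hh
  obtain ⟨w, hw⟩ := Ideal.mem_span_singleton.mp hghc
  have hw' : (g : B) * h = c * w := by exact_mod_cast congrArg (Subtype.val) hw
  have hhw : (h : B) = γ * w := by
    apply mul_left_cancel₀ hg0
    rw [hw', ← mul_assoc, hγc]
  have hvw : (w : B) * v = 1 := by
    apply mul_left_cancel₀ hγ0
    rw [← mul_assoc, ← hhw, hv, mul_one]
  obtain ⟨n, b, hnb⟩ := hA w w.2
  have hn : ¬ (ℓ : ℤ) ∣ n := by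
    rintro ⟨k, rfl⟩
    refine hP ((Ideal.eq_top_iff_one _).mpr ?_)
    rw [← hvw, hnb]
    refine P.mul_mem_right _ (add_mem ?_ (P.mul_mem_right _ hℓP))
    push_cast
    exact P.mul_mem_right _ hℓP
  have hmem : ∀ b, ∃ s ∈ J, (s : B) = ℓ * (γ * b) := fun b =>
    Ideal.exists_mem_of_mem_map_subring hm
      (hJ ▸ Ideal.mul_mem_right b _ (Ideal.mem_span_singleton_self γ))
  obtain ⟨s, hs, hs'⟩ := hmem b
  obtain ⟨u, hu, hu'⟩ := hmem 1
  have hcop : IsCoprime (ℓ : ℤ) n :=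
    (Nat.prime_iff_prime_int.mp hℓ.out).irreducible.coprime_iff_not_dvd.mpr hn
  obtain ⟨a, b', hab⟩ := hcop
  have hab' : (a : B) * ℓ + b' * n = 1 := by exact_mod_cast congrArg (Int.cast : ℤ → B) hab
  -- `w ≡ n` modulo `ℓ` with `n` prime to `ℓ`, so `nγ` and `ℓγ` are both in `J`.
  have hγJ : ∃ k ∈ J, (k : B) = γ := by
    refine ⟨a * u + b' * (h - s), add_mem (J.mul_mem_left _ hu)
      (J.mul_mem_left _ (sub_mem hh hs)), ?_⟩
    push_cast
    rw [hu', hs', hhw, hnb]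
    linear_combination γ * hab'
  obtain ⟨k, hk, hkγ⟩ := hγJ
  refine ⟨g, le_antisymm (fun x hx => ?_) ((Ideal.span_singleton_le_iff_mem _).mpr hg)⟩
  have hxk : x * k ∈ Ideal.span {c} := hIJ ▸ Ideal.mul_mem_mul hx hk
  obtain ⟨z, hz⟩ := Ideal.mem_span_singleton.mp hxk
  refine Ideal.mem_span_singleton.mpr ⟨z, Subtype.ext (mul_left_cancel₀ hγ0 ?_)⟩
  have hz' : (x : B) * k = c * z := by exact_mod_cast congrArg (Subtype.val) hz
  push_cast
  rw [mul_comm, ← hkγ, hz', ← hγc, hkγ]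
  ring

variable [IsDedekindDomain B]

/-- The class of the contraction of an ideal coprime to the conductor. -/
theorem ClassGroup.exists_extendedHom_eq_mk0 (hm : ∀ b, m * b ∈ A) (hmu : ¬ IsUnit m) {J : Ideal B}
    (hJ0 : J ≠ ⊥) (hJ : J ⊔ Ideal.span {m ^ 2} = ⊤) :
    ∃ u : (FractionalIdeal A⁰ (FractionRing A))ˣ,
      (u : FractionalIdeal A⁰ (FractionRing A)) = (J.comap (algebraMap A B) : Ideal A) ∧
      ClassGroup.extendedHom A B (ClassGroup.mk _ u) =
        ClassGroup.mk0 ⟨J, mem_nonZeroDivisors_of_ne_zero hJ0⟩ := by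
  obtain ⟨a, ha, c, hc, h1⟩ := Submodule.mem_sup.mp ((Ideal.eq_top_iff_one _).mp hJ)
  obtain ⟨r, rfl⟩ := Ideal.mem_span_singleton'.mp hc
  have ha' : a = 1 - m ^ 2 * r := by rw [← h1]; ring
  have haA : a ∈ A := by
    rw [ha', pow_two, mul_assoc]; exact sub_mem (one_mem _) (hm _)
  have ha0 : a ≠ 0 := by
    rintro rfl
    exact hmu (IsUnit.of_mul_eq_one (m * r) (by rw [← h1]; ring))
  obtain ⟨I, hI⟩ := Ideal.dvd_iff_le.mpr ((Ideal.span_singleton_le_iff_mem (I := J)).mpr ha)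
  have hmul := Ideal.comap_subring_mul_comap (a := ⟨a, haA⟩) hm ha' hI.symm
  have hne : (⟨a, haA⟩ : A) ≠ 0 := fun h => ha0 (congrArg Subtype.val h)
  obtain ⟨u, hu⟩ := FractionalIdeal.isUnit_coeIdeal_of_mul_eq hne hmul
  refine ⟨u, hu, ?_⟩
  rw [ClassGroup.extendedHom_mk, ← ClassGroup.mk_mk0 (FractionRing B)]
  congr 1
  ext1
  have hJm : J ⊔ Ideal.span {m} = ⊤ := by
    rw [eq_top_iff, ← hJ]
    refine sup_le_sup_left ?_ _
    rw [Ideal.span_singleton_le_span_singleton]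
    exact dvd_pow_self m two_ne_zero
  rw [FractionalIdeal.coe_mk0]
  change FractionalIdeal.extendedHom (FractionRing B) B
    (u : FractionalIdeal A⁰ (FractionRing A)) = _
  rw [hu, FractionalIdeal.extendedHom_coeIdeal_eq_map, Ideal.map_comap_subring_of_isCoprime hm hJm]

/-- Extension of ideal classes from a subring with nonzero conductor is surjective. -/
theorem ClassGroup.extendedHom_surjective_of_conductor (hm : ∀ b, m * b ∈ A) (hm0 : m ≠ 0)
    (hmu : ¬ IsUnit m) : Function.Surjective (ClassGroup.extendedHom A B) := by
  intro x
  obtain ⟨⟨K, hK⟩, hKx⟩ := ClassGroup.mk0_surjective x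
  have hK0 : K ≠ ⊥ := nonZeroDivisors.ne_zero hK
  have hle : K * Ideal.span {m ^ 2} ≤ K := Ideal.mul_le_left
  have hne : K * Ideal.span {m ^ 2} ≠ 0 :=
    mul_ne_zero hK0 (by simpa using hm0)
  -- From `aB = KJ` and `K m² + aB = K`, cancelling `K` shows that `J` is coprime to `m²`; the class
  -- of `K` is the inverse of that of `J`.
  obtain ⟨a, ha⟩ := IsDedekindDomain.exists_sup_span_eq hle hne
  have haK : Ideal.span {a} ≤ K := ha ▸ le_sup_right
  obtain ⟨J, hJ⟩ := Ideal.dvd_iff_le.mpr haK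
  have hJtop : J ⊔ Ideal.span {m ^ 2} = ⊤ := by
    rw [hJ, ← Ideal.mul_sup, sup_comm] at ha
    exact mul_left_cancel₀ hK0 (ha.trans (Ideal.mul_top K).symm)
  have hJ0 : J ≠ ⊥ := by
    rintro rfl
    rw [bot_sup_eq, Ideal.span_singleton_eq_top] at hJtop
    exact hmu ((isUnit_pow_iff two_ne_zero).mp hJtop)
  obtain ⟨u, -, hu⟩ := ClassGroup.exists_extendedHom_eq_mk0 hm hmu hJ0 hJtop
  refine ⟨(ClassGroup.mk _ u)⁻¹, ?_⟩
  rw [map_inv, hu, ← hKx, eq_comm, ClassGroup.mk0_eq_mk0_inv_iff]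
  refine ⟨a, ?_, hJ.symm⟩
  rintro rfl
  rw [Ideal.span_singleton_eq_bot.mpr rfl] at hJ
  exact (mul_ne_zero hK0 hJ0) hJ.symm

/-- Extension of ideal classes from `ℤ + ℓ B` is injective if every residue outside `P` is
represented by an integral multiple of a unit. -/
theorem ClassGroup.extendedHom_injective_of_units {ℓ : ℕ} [hℓ : Fact ℓ.Prime]
    (hm : ∀ b : B, (ℓ : B) * b ∈ A) (hA : ∀ a ∈ A, ∃ (n : ℤ) (b : B), a = n + ℓ * b)
    {P : Ideal B} (hP : P ≠ ⊤) (hℓP : (ℓ : B) ∈ P)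
    (hU : ∀ b ∉ P, ∃ (η : Bˣ) (c : ℤ) (w : B), b = c * η + ℓ * w) :
    Function.Injective (ClassGroup.extendedHom A B) := by
  rw [injective_iff_map_eq_one]
  intro x hx
  obtain ⟨I, J, c, u, hc, hIJ, hu, rfl⟩ := ClassGroup.exists_integral_rep x
  rw [ClassGroup.extendedHom_mk, ClassGroup.mk_eq_one_of_coe_ideal
    (I' := I.map (algebraMap A B))] at hx
  · obtain ⟨β, -, hβ⟩ := hx
    obtain ⟨g, rfl⟩ := Ideal.eq_span_of_map_eq_span hm hA hP hℓP hU hc hIJ hβ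
    refine (ClassGroup.mk_eq_one_of_coe_ideal hu).mpr ⟨g, ?_, rfl⟩
    rintro rfl
    rw [Ideal.span_singleton_eq_bot.mpr rfl, Ideal.bot_mul] at hIJ
    exact hc (Ideal.span_singleton_eq_bot.mp hIJ.symm)
  · change FractionalIdeal.extendedHom (FractionRing B) B
      (u : FractionalIdeal A⁰ (FractionRing A)) = _
    rw [hu, FractionalIdeal.extendedHom_coeIdeal_eq_map]

/-- If extension of ideal classes is injective, elements coprime to the conductor are
associated to elements of the subring. -/
theorem ClassGroup.exists_associated_of_extendedHom_injective (hm : ∀ b, m * b ∈ A)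
    (hmu : ¬ IsUnit m) (hinj : Function.Injective (ClassGroup.extendedHom A B)) {α : B}
    (hα : IsCoprime α m) : ∃ g ∈ A, Associated g α := by
  have hα0 : α ≠ 0 := by
    rintro rfl
    exact hmu (isCoprime_zero_left.mp hα)
  have htop : Ideal.span {α} ⊔ Ideal.span {m ^ 2} = ⊤ :=
    (Ideal.isCoprime_span_singleton_iff _ _).mpr hα.pow_right |>.sup_eq
  have hne : Ideal.span {α} ≠ ⊥ := by simpa using hα0
  obtain ⟨u, hu, hu'⟩ := ClassGroup.exists_extendedHom_eq_mk0 hm hmu hne htop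
  rw [(ClassGroup.mk0_eq_one_iff _).mpr ⟨⟨α, rfl⟩⟩, ← map_one (ClassGroup.extendedHom A B)] at hu'
  obtain ⟨g, -, hg⟩ := (ClassGroup.mk_eq_one_of_coe_ideal hu).mp (hinj hu')
  refine ⟨g, g.2, Ideal.span_singleton_eq_span_singleton.mp ?_⟩
  rw [← Ideal.map_comap_subring_of_isCoprime hm
    ((Ideal.isCoprime_span_singleton_iff _ _).mpr hα).sup_eq, hg, Ideal.map_span,
    Set.image_singleton]
  rfl

end Conductor

/-! ### Integral coordinates in the ring of integers. -/

namespace RealQuadratic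

theorem finiteDimensional_quadField (d : ℕ) : FiniteDimensional ℚ (quadField d) := by
  apply IntermediateField.adjoin.finiteDimensional
  refine ⟨Polynomial.X ^ 2 - Polynomial.C (d : ℚ), Polynomial.monic_X_pow_sub_C _ two_ne_zero, ?_⟩
  simp

instance (d : ℕ) : NumberField (quadField d) where
  to_finiteDimensional := finiteDimensional_quadField d

/-- The embedding of `𝒪_K` into the real numbers, as a ring homomorphism. -/
noncomputable def toRealHom (d : ℕ) : maxOrder d →+* ℝ :=
  (algebraMap (quadField d) ℝ).comp (algebraMap (maxOrder d) (quadField d))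

theorem toRealHom_apply {d : ℕ} (z : maxOrder d) : toRealHom d z = toReal z := rfl

theorem toRealHom_injective (d : ℕ) : Function.Injective (toRealHom d) :=
  (algebraMap (quadField d) ℝ).injective.comp (NumberField.RingOfIntegers.coe_injective)

/-- The trace of `ω`. -/
def omegaTrace (d : ℕ) : ℤ := if d % 4 = 1 then 1 else 0

/-- The negative of the norm of `ω`. -/
def omegaConst (d : ℕ) : ℤ := if d % 4 = 1 then ((d : ℤ) - 1) / 4 else d

theorem omegaTrace_sq_add (d : ℕ) : (omegaTrace d) ^ 2 + 4 * omegaConst d = disc d := by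
  unfold omegaTrace omegaConst disc
  split_ifs <;> omega

theorem omega_sq (d : ℕ) : omega d * omega d = omegaConst d + omegaTrace d * omega d := by
  have hs : Real.sqrt d * Real.sqrt d = d := Real.mul_self_sqrt (Nat.cast_nonneg d)
  unfold omegaTrace omegaConst omega
  split_ifs with h
  · obtain ⟨k, hk⟩ : ∃ k : ℤ, (d : ℤ) = 4 * k + 1 := ⟨d / 4, by omega⟩
    have hk' : (d : ℝ) = 4 * k + 1 := by exact_mod_cast hk
    rw [hk, show (4 * k + 1 - 1) / 4 = k by omega]
    push_cast
    linear_combination (1 / 4) * hs + (1 / 4) * hk'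
  · push_cast
    linear_combination hs

theorem two_mul_omega_sub (d : ℕ) : 2 * omega d - omegaTrace d =
    if d % 4 = 1 then Real.sqrt d else 2 * Real.sqrt d := by
  unfold omegaTrace omega
  split_ifs <;> push_cast <;> ring

theorem irrational_sqrt {d : ℕ} (hd2 : 2 ≤ d) (hd : Squarefree d) : Irrational (Real.sqrt d) := by
  rw [irrational_sqrt_natCast_iff]
  rintro ⟨r, rfl⟩
  have := hd r dvd_rfl
  rw [Nat.isUnit_iff] at this
  subst this
  omega

theorem omega_mem (d : ℕ) : omega d ∈ quadField d := by
  have h : Real.sqrt d ∈ quadField d := IntermediateField.mem_adjoin_simple_self ℚ _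
  unfold omega
  split_ifs
  · exact div_mem (add_mem (one_mem _) h) (ofNat_mem _ 2)
  · exact h

theorem isIntegral_omega (d : ℕ) : IsIntegral ℤ (omega d) := by
  refine ⟨Polynomial.X ^ 2 - (Polynomial.C (omegaTrace d) * Polynomial.X
    + Polynomial.C (omegaConst d)), ?_, ?_⟩
  · apply Polynomial.monic_X_pow_sub
    compute_degree
    exact_mod_cast one_lt_two
  · simp only [Polynomial.eval₂_sub, Polynomial.eval₂_pow, Polynomial.eval₂_X,
      Polynomial.eval₂_add, Polynomial.eval₂_mul, Polynomial.eval₂_C]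
    simp only [eq_intCast]
    rw [pow_two, omega_sq]
    ring

/-- The element `ω` of `𝒪_K`. -/
noncomputable def om (d : ℕ) : maxOrder d :=
  ⟨⟨omega d, omega_mem d⟩, by
    have := isIntegral_omega d
    exact (isIntegral_algebraMap_iff (algebraMap (quadField d) ℝ).injective).mp this⟩

theorem toRealHom_om (d : ℕ) : toRealHom d (om d) = omega d := rfl

theorem om_sq (d : ℕ) : om d * om d = omegaConst d + omegaTrace d * om d := by
  apply toRealHom_injective
  simp [toRealHom_om, omega_sq]

theorem mem_quadField_iff {d : ℕ} {v : ℝ} (hv : v ∈ quadField d) :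
    ∃ a b : ℚ, v = a + b * Real.sqrt d := by
  have hs : Real.sqrt d * Real.sqrt d = d := Real.mul_self_sqrt (Nat.cast_nonneg d)
  have hint : IsIntegral ℚ (Real.sqrt d) :=
    ⟨Polynomial.X ^ 2 - Polynomial.C (d : ℚ), Polynomial.monic_X_pow_sub_C _ two_ne_zero, by simp⟩
  rw [← IntermediateField.mem_toSubalgebra,
    IntermediateField.adjoin_simple_toSubalgebra_of_isAlgebraic hint.isAlgebraic] at hv
  induction hv using Algebra.adjoin_induction with
  | mem x hx =>
    rw [Set.mem_singleton_iff] at hx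
    exact ⟨0, 1, by simp [hx]⟩
  | algebraMap r => exact ⟨r, 0, by simp⟩
  | add x y _ _ hx hy =>
    obtain ⟨a, b, rfl⟩ := hx
    obtain ⟨a', b', rfl⟩ := hy
    exact ⟨a + a', b + b', by push_cast; ring⟩
  | mul x y _ _ hx hy =>
    obtain ⟨a, b, rfl⟩ := hx
    obtain ⟨a', b', rfl⟩ := hy
    exact ⟨a * a' + b * b' * d, a * b' + a' * b, by
      push_cast; linear_combination (b : ℝ) * b' * hs⟩

/-- The conjugation of the abstract quadratic algebra preserves integrality, and irrationality of
`√d` embeds that algebra into `ℝ`. This makes trace and norm integers in `exists_coords`. -/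
theorem isIntegral_conj {d : ℕ} (hd : Irrational (Real.sqrt d)) {a b : ℚ}
    (h : IsIntegral ℤ ((a : ℝ) + b * Real.sqrt d)) : IsIntegral ℤ ((a : ℝ) - b * Real.sqrt d) := by
  have hs : Real.sqrt d * Real.sqrt d = d := Real.mul_self_sqrt (Nat.cast_nonneg d)
  let φ : QuadraticAlgebra ℚ (d : ℚ) 0 →ₐ[ℚ] ℝ :=
    QuadraticAlgebra.lift ⟨Real.sqrt d, by simp [hs, Algebra.smul_def]⟩
  have hφ (z : QuadraticAlgebra ℚ (d : ℚ) 0) : φ z = z.re + z.im * Real.sqrt d := by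
    simp [φ, QuadraticAlgebra.lift, Algebra.smul_def]
  have hinj : Function.Injective φ := by
    rw [injective_iff_map_eq_zero]
    intro z hz
    rw [hφ] at hz
    have him : z.im = 0 := by
      by_contra him
      refine (hd.ratCast_mul him).ne_rat (-z.re) ?_
      push_cast
      linear_combination hz
    rw [him] at hz
    ext
    · simpa using hz
    · simpa using him
  let z : QuadraticAlgebra ℚ (d : ℚ) 0 := ⟨a, b⟩
  have hz : IsIntegral ℤ z := by
    refine (isIntegral_algHom_iff (φ.restrictScalars ℤ) hinj).mp ?_
    simpa [hφ, z] using h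
  have hstar : IsIntegral ℤ (star z) :=
    map_isIntegral_int (starRingEnd (QuadraticAlgebra ℚ (d : ℚ) 0)) hz
  have := map_isIntegral_int (φ : QuadraticAlgebra ℚ (d : ℚ) 0 →+* ℝ) hstar
  simpa [hφ, z, sub_eq_add_neg] using this

theorem exists_int_of_isIntegral_ratCast {r : ℚ} (h : IsIntegral ℤ (r : ℝ)) :
    ∃ n : ℤ, (n : ℚ) = r := by
  have h1 : IsIntegral ℤ (algebraMap ℚ ℝ r) := h
  rw [isIntegral_algebraMap_iff (algebraMap ℚ ℝ).injective] at h1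
  exact IsIntegrallyClosed.isIntegral_iff.mp h1

/-- The square of the denominator of `r` must divide `d`. It is applied to twice the coefficient of
`√d`. -/
theorem exists_int_of_squarefree_mul_sq {d : ℕ} (hd : Squarefree d) {r : ℚ} {n : ℤ}
    (h : d * r ^ 2 = n) : ∃ k : ℤ, (k : ℚ) = r := by
  have hden : (r.den : ℚ) ≠ 0 := by exact_mod_cast r.den_ne_zero
  have h1 : (d : ℚ) * r.num ^ 2 = n * r.den ^ 2 := by
    have h2 : r * r.den = r.num := Rat.mul_den_eq_num r
    rw [← h, ← h2]; ring
  have h2 : (d : ℤ) * r.num ^ 2 = n * (r.den : ℤ) ^ 2 := by exact_mod_cast h1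
  have hcop : IsCoprime ((r.den : ℤ) ^ 2) (r.num ^ 2) := by
    refine IsCoprime.pow ?_
    rw [Int.isCoprime_iff_nat_coprime]
    simpa using r.reduced.symm
  have hdvd : (r.den : ℤ) ^ 2 ∣ d := hcop.dvd_of_dvd_mul_right ⟨n, by rw [h2, mul_comm]⟩
  have hone : r.den = 1 := by
    rw [← Nat.isUnit_iff]
    apply hd
    rw [← pow_two]
    exact_mod_cast hdvd
  exact ⟨r.num, Rat.coe_int_num_of_den_eq_one hone⟩

/-- Coordinates of the algebraic integers of `ℚ(√d)`. -/
theorem exists_coords {d : ℕ} (hd2 : 2 ≤ d) (hd : Squarefree d) (z : maxOrder d) :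
    ∃ a b : ℤ, z = a + b * om d := by
  obtain ⟨a, b, hab⟩ := mem_quadField_iff (z : quadField d).2
  have hs : Real.sqrt d * Real.sqrt d = d := Real.mul_self_sqrt (Nat.cast_nonneg d)
  have hirr := irrational_sqrt hd2 hd
  have hz : IsIntegral ℤ ((a : ℝ) + b * Real.sqrt d) := by
    rw [← hab]
    exact map_isIntegral_int (algebraMap (quadField d) ℝ) z.2
  have hz' := isIntegral_conj hirr hz
  obtain ⟨A, hA⟩ := exists_int_of_isIntegral_ratCast (r := 2 * a) (by
    have h : ((2 * a : ℚ) : ℝ) = (a + b * Real.sqrt d) + (a - b * Real.sqrt d) := by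
      push_cast; ring
    rw [h]; exact hz.add hz')
  obtain ⟨N, hN⟩ := exists_int_of_isIntegral_ratCast (r := a ^ 2 - d * b ^ 2) (by
    have h : ((a ^ 2 - d * b ^ 2 : ℚ) : ℝ) = (a + b * Real.sqrt d) * (a - b * Real.sqrt d) := by
      push_cast; linear_combination (b : ℝ) ^ 2 * hs
    rw [h]; exact hz.mul hz')
  obtain ⟨C, hC⟩ := exists_int_of_squarefree_mul_sq hd (r := 2 * b) (n := A ^ 2 - 4 * N) (by
    push_cast; rw [hA, hN]; ring)
  have heq : A ^ 2 - d * C ^ 2 = 4 * N := by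
    have : (A : ℚ) ^ 2 - d * C ^ 2 = 4 * N := by rw [hA, hN, hC]; ring
    exact_mod_cast this
  have ha : (a : ℝ) = A / 2 := by
    have : a = A / 2 := by rw [hA]; ring
    rw [this]; push_cast; rfl
  have hb : (b : ℝ) = C / 2 := by
    have : b = C / 2 := by rw [hC]; ring
    rw [this]; push_cast; rfl
  have hd4 : d % 4 ≠ 0 := by
    intro h0
    have := hd 2 (by omega)
    simp at this
  by_cases h1 : d % 4 = 1
  · have hpar : A % 2 = C % 2 := by
      obtain ⟨k, hk⟩ : ∃ k : ℤ, (d : ℤ) = 4 * k + 1 := ⟨d / 4, by omega⟩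
      rw [hk] at heq
      have h2 : (A - C) * (A + C) = 4 * (N + k * C ^ 2) := by linear_combination heq
      have : (2 : ℤ) ∣ (A - C) * (A + C) := ⟨2 * (N + k * C ^ 2), by rw [h2]; ring⟩
      rcases Int.prime_two.dvd_or_dvd this with h | h <;> omega
    obtain ⟨k, hk⟩ : ∃ k : ℤ, A = 2 * k + C := ⟨(A - C) / 2, by omega⟩
    refine ⟨k, C, toRealHom_injective d ?_⟩
    rw [map_add, map_mul, map_intCast, map_intCast, toRealHom_om, omega, if_pos h1]
    change ((z : quadField d) : ℝ) = _
    rw [hab, ha, hb, hk]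
    push_cast
    ring
  · have hpar : A % 2 = 0 ∧ C % 2 = 0 := by
      have h4 : (A ^ 2 - d * C ^ 2) % 4 = 0 := by omega
      have hd' : (d : ℤ) % 4 = 2 ∨ (d : ℤ) % 4 = 3 := by omega
      have hA4 : A % 4 = 0 ∨ A % 4 = 1 ∨ A % 4 = 2 ∨ A % 4 = 3 := by omega
      have hC4 : C % 4 = 0 ∨ C % 4 = 1 ∨ C % 4 = 2 ∨ C % 4 = 3 := by omega
      rcases hd' with h | h <;> rcases hA4 with h' | h' | h' | h' <;>
        rcases hC4 with h'' | h'' | h'' | h'' <;>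
        first
        | omega
        | (exfalso; revert h4; rw [Int.sub_emod, Int.mul_emod, pow_two, pow_two, Int.mul_emod A,
            Int.mul_emod C, h, h', h'']; decide)
    refine ⟨A / 2, C / 2, toRealHom_injective d ?_⟩
    rw [map_add, map_mul, map_intCast, map_intCast, toRealHom_om, omega, if_neg h1]
    change ((z : quadField d) : ℝ) = _
    obtain ⟨k, hk⟩ : ∃ k : ℤ, A = 2 * k := ⟨A / 2, by omega⟩
    obtain ⟨j, hj⟩ : ∃ j : ℤ, C = 2 * j := ⟨C / 2, by omega⟩
    rw [hab, ha, hb, hk, hj]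
    simp

theorem coords_eq_zero {d : ℕ} (hd2 : 2 ≤ d) (hd : Squarefree d) {a b : ℤ}
    (h : (a : maxOrder d) + b * om d = 0) : a = 0 ∧ b = 0 := by
  have h' := congrArg (toRealHom d) h
  rw [map_add, map_mul, map_intCast, map_intCast, toRealHom_om, map_zero] at h'
  have hirr := irrational_sqrt hd2 hd
  have hω := two_mul_omega_sub d
  have h2 : (2 * a + b * omegaTrace d : ℝ) +
      b * (if d % 4 = 1 then Real.sqrt d else 2 * Real.sqrt d) = 0 := by
    rw [← hω]; linear_combination 2 * h'
  have hb : b = 0 := by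
    by_contra hb
    split_ifs at h2
    · refine (hirr.intCast_mul hb).ne_int (-(2 * a + b * omegaTrace d)) ?_
      push_cast; linear_combination h2
    · refine (hirr.intCast_mul (m := 2 * b) (by omega)).ne_int (-(2 * a + b * omegaTrace d)) ?_
      push_cast; linear_combination h2
  subst hb
  simpa using h

/-- The ring of integers of `ℚ(√d)` as a quadratic algebra over `ℤ`. -/
noncomputable def quadEquiv {d : ℕ} (hd2 : 2 ≤ d) (hd : Squarefree d) :
    QuadraticAlgebra ℤ (omegaConst d) (omegaTrace d) ≃ₐ[ℤ] maxOrder d :=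
  AlgEquiv.ofBijective
    (QuadraticAlgebra.lift ⟨om d, by simp [om_sq, Algebra.smul_def]⟩) (by
      have hφ (z : QuadraticAlgebra ℤ (omegaConst d) (omegaTrace d)) :
          (QuadraticAlgebra.lift ⟨om d, by simp [om_sq, Algebra.smul_def]⟩ :
            QuadraticAlgebra ℤ (omegaConst d) (omegaTrace d) →ₐ[ℤ] maxOrder d) z
            = z.re + z.im * om d := by
        simp [QuadraticAlgebra.lift, Algebra.smul_def]
      constructor
      · rw [injective_iff_map_eq_zero]
        intro z hz
        rw [hφ] at hz
        obtain ⟨h1, h2⟩ := coords_eq_zero hd2 hd hz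
        ext <;> simpa
      · intro z
        obtain ⟨a, b, rfl⟩ := exists_coords hd2 hd z
        exact ⟨⟨a, b⟩, by rw [hφ]⟩)

theorem quadEquiv_apply {d : ℕ} (hd2 : 2 ≤ d) (hd : Squarefree d)
    (z : QuadraticAlgebra ℤ (omegaConst d) (omegaTrace d)) :
    quadEquiv hd2 hd z = z.re + z.im * om d := by
  simp [quadEquiv, QuadraticAlgebra.lift, Algebra.smul_def]


/-! ### Residues modulo a prime divisor of `d`. -/

/-- The element `√d` of `𝒪_K`. -/
noncomputable def rootD (d : ℕ) : maxOrder d := if d % 4 = 1 then 2 * om d - 1 else om d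

theorem toRealHom_rootD (d : ℕ) : toRealHom d (rootD d) = Real.sqrt d := by
  unfold rootD
  split_ifs with h
  · rw [map_sub, map_mul, map_ofNat, map_one, toRealHom_om, omega, if_pos h]
    ring
  · rw [toRealHom_om, omega, if_neg h]

theorem rootD_mul_self (d : ℕ) : rootD d * rootD d = d := by
  apply toRealHom_injective
  rw [map_mul, toRealHom_rootD, map_natCast]
  exact Real.mul_self_sqrt (Nat.cast_nonneg d)

theorem intCast_dvd (hd2 : 2 ≤ d) (hd : Squarefree d) {m n : ℤ}
    (h : (m : maxOrder d) ∣ n) : m ∣ n := by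
  obtain ⟨z, hz⟩ := h
  obtain ⟨a, b, rfl⟩ := exists_coords hd2 hd z
  have h0 : ((m * a - n : ℤ) : maxOrder d) + (m * b : ℤ) * om d = 0 := by
    push_cast; rw [hz]; ring
  exact ⟨a, by linarith [(coords_eq_zero hd2 hd h0).1]⟩

theorem mem_order_iff (hd2 : 2 ≤ d) (hd : Squarefree d) {f : ℕ} {a b : ℤ} :
    (a : maxOrder d) + b * om d ∈ order d f ↔ (f : ℤ) ∣ b := by
  constructor
  · rintro ⟨n, w, h⟩
    obtain ⟨a', b', rfl⟩ := exists_coords hd2 hd w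
    have h0 : ((a - n - f * a' : ℤ) : maxOrder d) + (b - f * b' : ℤ) * om d = 0 := by
      push_cast; linear_combination h
    exact ⟨b', by linarith [(coords_eq_zero hd2 hd h0).2]⟩
  · rintro ⟨k, rfl⟩
    exact ⟨a, k * om d, by push_cast; ring⟩

theorem conductor_mul_mem (d f : ℕ) (b : maxOrder d) : (f : maxOrder d) * b ∈ order d f :=
  ⟨0, b, by simp⟩

theorem not_isUnit_natCast (hd2 : 2 ≤ d) (hd : Squarefree d) {n : ℕ} (hn : n ≠ 1) :
    ¬ IsUnit (n : maxOrder d) := by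
  intro h
  have h1 : ((n : ℤ) : maxOrder d) ∣ ((1 : ℤ) : maxOrder d) := by
    push_cast; exact h.dvd
  have := intCast_dvd hd2 hd h1
  exact hn (by exact_mod_cast Int.eq_one_of_dvd_one (by positivity) this)

/-- Allows computation modulo `ℓ` in the basis `1, δ` with `δ² = 0`. If `d ≡ 1 mod 4`, then `ℓ` is
odd and `j = k = (ℓ + 1) / 2` is the inverse of `2`. -/
theorem exists_om_eq (ℓ : ℕ) (hℓ : ℓ.Prime) (hℓd : ℓ ∣ d) :
    ∃ (j k : ℤ) (w : maxOrder d), ¬ (ℓ : ℤ) ∣ k ∧ om d = j + k * rootD d + ℓ * w := by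
  by_cases h : d % 4 = 1
  · obtain ⟨k, hk⟩ : ∃ k, ℓ + 1 = 2 * k := by
      have : ℓ % 2 = 1 := by
        by_contra h2
        have : 2 ∣ d := (Nat.dvd_of_mod_eq_zero (by omega)).trans hℓd
        omega
      exact ⟨(ℓ + 1) / 2, by omega⟩
    refine ⟨k, k, -om d, ?_, ?_⟩
    · intro hdvd
      have h1 : (ℓ : ℤ) ∣ 1 := by
        have : (1 : ℤ) = 2 * k - ℓ := by
          have : ((ℓ + 1 : ℕ) : ℤ) = (2 * k : ℕ) := by rw [hk]
          push_cast at this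
          linarith
        rw [this]
        exact dvd_sub (Dvd.dvd.mul_left hdvd 2) dvd_rfl
      exact hℓ.one_lt.ne' (by exact_mod_cast Int.eq_one_of_dvd_one (by positivity) h1)
    · have hk' : ((ℓ + 1 : ℕ) : maxOrder d) = (2 * k : ℕ) := by rw [hk]
      push_cast at hk'
      rw [rootD, if_pos h]
      push_cast
      linear_combination om d * hk'
  · refine ⟨0, 1, 0, ?_, ?_⟩
    · intro h1
      exact hℓ.one_lt.ne' (by exact_mod_cast Int.eq_one_of_dvd_one (by positivity) h1)
    · rw [rootD, if_neg h]; simp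

/-- The ramified prime ideal above a prime divisor of `d` is proper. -/
theorem span_rootD_ne_top (hd2 : 2 ≤ d) (hd : Squarefree d) {ℓ : ℕ} (hℓ : ℓ.Prime)
    (hℓd : ℓ ∣ d) : Ideal.span {rootD d, (ℓ : maxOrder d)} ≠ ⊤ := by
  rw [Ne, Ideal.eq_top_iff_one, Ideal.mem_span_pair]
  rintro ⟨a, b, h⟩
  obtain ⟨e, rfl⟩ := hℓd
  -- If `1 = aδ + bℓ`, multiplying by `δ` shows `ℓ ∣ δ`, hence `ℓ² ∣ δ² = d`.
  have h1 : rootD (ℓ * e) = ℓ * (a * e + b * rootD (ℓ * e)) := by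
    have := rootD_mul_self (ℓ * e)
    push_cast at this
    linear_combination a * this - rootD (ℓ * e) * h
  have h2 : (((ℓ * ℓ : ℕ) : ℤ) : maxOrder (ℓ * e)) ∣ (((ℓ * e : ℕ) : ℤ) : maxOrder (ℓ * e)) := by
    rw [Int.cast_natCast, Int.cast_natCast, ← rootD_mul_self (ℓ * e), Nat.cast_mul]
    exact mul_dvd_mul ⟨_, h1⟩ ⟨_, h1⟩
  have h3 := hd ℓ (by exact_mod_cast intCast_dvd hd2 hd h2)
  exact hℓ.one_lt.ne' (Nat.isUnit_iff.mp h3)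

/-- Up to an integer factor, a residue outside the prime above `ℓ` is `1 + tδ`, and `ε` is such an
element with `t ≠ 0` because `ℓ ∤ y`. Its powers multiply `t` by `n`, so they reach every `t` modulo
`ℓ`. -/
theorem exists_residue (hd2 : 2 ≤ d) (hd : Squarefree d) {ℓ : ℕ} (hℓ : ℓ.Prime)
    (hℓd : ℓ ∣ d) {ε : (maxOrder d)ˣ} {x y : ℤ} (hε : (ε : maxOrder d) = x + y * om d)
    (hy : ¬ (ℓ : ℤ) ∣ y) (b : maxOrder d) (hb : b ∉ Ideal.span {rootD d, (ℓ : maxOrder d)}) :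
    ∃ (η : (maxOrder d)ˣ) (c : ℤ) (w : maxOrder d), b = c * η + ℓ * w := by
  have hPtop := span_rootD_ne_top hd2 hd hℓ hℓd
  set P := Ideal.span {rootD d, (ℓ : maxOrder d)} with hP
  have hδP : rootD d ∈ P := Ideal.subset_span (by simp)
  have hℓP : (ℓ : maxOrder d) ∈ P := Ideal.subset_span (by simp)
  obtain ⟨j, k, w, hk, hw⟩ := exists_om_eq (d := d) ℓ hℓ hℓd
  obtain ⟨u₀, v₀, rfl⟩ := exists_coords hd2 hd b
  have hp := Nat.prime_iff_prime_int.mp hℓ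
  obtain ⟨Q, _, π, hπ, hker⟩ : ∃ (Q : Type) (_ : CommRing Q) (π : maxOrder d →+* Q),
      Function.Surjective π ∧ RingHom.ker π = Ideal.span {(ℓ : maxOrder d)} :=
    ⟨maxOrder d ⧸ Ideal.span {(ℓ : maxOrder d)}, inferInstance, Ideal.Quotient.mk _,
      Ideal.Quotient.mk_surjective, Ideal.mk_ker⟩
  have hℓ0 : (ℓ : Q) = 0 := by
    rw [← map_natCast π, ← RingHom.mem_ker, hker]
    exact Ideal.mem_span_singleton_self _
  have hδ0 : π (rootD d) * π (rootD d) = 0 := by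
    obtain ⟨e, he⟩ := hℓd
    rw [← map_mul, rootD_mul_self, map_natCast, he, Nat.cast_mul, hℓ0, zero_mul]
  have hinv : ∀ a : ℤ, ¬ (ℓ : ℤ) ∣ a → ∃ s : ℤ, (s : Q) * a = 1 := by
    intro a ha
    obtain ⟨t, s, hts⟩ := hp.irreducible.coprime_iff_not_dvd.mpr ha
    refine ⟨s, ?_⟩
    have := congrArg (Int.cast : ℤ → Q) hts
    push_cast at this
    rwa [hℓ0, mul_zero, zero_add] at this
  have hndvd : ∀ a b : ℤ, (a : maxOrder d) + b * om d ∉ P → ¬ (ℓ : ℤ) ∣ a + b * j := by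
    rintro a b hab ⟨e, he⟩
    apply hab
    have he' := congrArg (Int.cast : ℤ → maxOrder d) he
    push_cast at he'
    have : (a : maxOrder d) + b * om d = ℓ * (e + b * w) + (b * k) * rootD d := by
      rw [hw]; linear_combination he'
    rw [this]
    exact add_mem (P.mul_mem_right _ hℓP) (P.mul_mem_left _ hδP)
  have hπom : ∀ a b : ℤ, π (a + b * om d) = (a + b * j : ℤ) + (b * k : ℤ) * π (rootD d) := by
    intro a b
    rw [hw]
    simp only [map_add, map_mul, map_intCast, map_natCast, hℓ0]
    push_cast; ring
  have hεP : (ε : maxOrder d) ∉ P := fun h => hPtop (P.eq_top_of_isUnit_mem h ε.isUnit)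
  obtain ⟨s, hs⟩ := hinv _ (hndvd x y (hε ▸ hεP))
  obtain ⟨e, he⟩ := hinv (y * k) (fun h => (hp.dvd_or_dvd h).elim hy hk)
  obtain ⟨g, hg⟩ := hinv _ (hndvd u₀ v₀ hb)
  have hεπ := hπom x y
  have hbπ := hπom u₀ v₀
  rw [← hε] at hεπ
  set x₁ := x + y * j
  set y₁ := y * k
  set u := u₀ + v₀ * j
  set v := v₀ * k
  have hpow : ∀ n : ℕ, π ε ^ n = x₁ ^ n * (1 + n * s * y₁ * π (rootD d)) := by
    intro n
    induction n with
    | zero => simp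
    | succ n ih =>
      rw [pow_succ, ih, hεπ]
      push_cast
      linear_combination (x₁ ^ n * n * s * y₁ * y₁ : Q) * hδ0
        - (x₁ ^ n * y₁ * π (rootD d) : Q) * hs
  -- Here `s, e, g` invert `x₁, y₁, u`; the exponent solves `n s y₁ = v g`, so that `u (1 + n s y₁
  -- δ) = u + vδ`.
  obtain ⟨n, hn⟩ : ∃ n : ℕ, (n : Q) = v * x₁ * e * g := by
    refine ⟨((v * x₁ * e * g) % (ℓ : ℤ)).toNat, ?_⟩
    have h1 : ((((v * x₁ * e * g) % (ℓ : ℤ)).toNat : ℤ)) = (v * x₁ * e * g) % (ℓ : ℤ) :=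
      Int.toNat_of_nonneg (Int.emod_nonneg _ (by exact_mod_cast hℓ.ne_zero))
    have h2 := Int.emod_add_mul_ediv (v * x₁ * e * g) ℓ
    have h3 := congrArg (Int.cast : ℤ → Q) h2
    rw [← h1] at h3
    push_cast at h3
    rwa [hℓ0, zero_mul, add_zero] at h3
  have hmem : (u₀ : maxOrder d) + v₀ * om d -
      (u * s ^ n : ℤ) * ((ε ^ n : (maxOrder d)ˣ) : maxOrder d)
      ∈ Ideal.span {(ℓ : maxOrder d)} := by
    rw [← hker, RingHom.mem_ker, map_sub, hbπ, map_mul, map_intCast, Units.val_pow_eq_pow_val,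
      map_pow, hpow, hn]
    have hsn : (s : Q) ^ n * x₁ ^ n = 1 := by rw [← mul_pow, hs, one_pow]
    push_cast
    have h1 : (u : Q) * s ^ n * (x₁ ^ n * (1 + v * x₁ * e * g * s * y₁ * π (rootD d))) =
        (s ^ n * x₁ ^ n) * (u + v * ((s * x₁) * (e * y₁) * (g * u)) * π (rootD d)) := by ring
    rw [h1, hsn, hs, he, hg]
    ring
  obtain ⟨z, hz⟩ := Ideal.mem_span_singleton.mp hmem
  exact ⟨ε ^ n, u * s ^ n, z, by rw [← hz]; ring⟩

/-! ### Class numbers of the orders. -/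

theorem classNumber_eq (d : ℕ) : classNumber d = Nat.card (ClassGroup (maxOrder d)) :=
  (Nat.card_congr (ClassGroup.equivPic (maxOrder d)).toEquiv).symm

theorem orderClassNumber_eq (d f : ℕ) :
    orderClassNumber d f = Nat.card (ClassGroup (order d f)) :=
  (Nat.card_congr (ClassGroup.equivPic (order d f)).toEquiv).symm

theorem extendedHom_order_surjective (hd2 : 2 ≤ d) (hd : Squarefree d) {f : ℕ} (hf0 : f ≠ 0)
    (hf1 : f ≠ 1) : Function.Surjective (ClassGroup.extendedHom (order d f) (maxOrder d)) :=
  ClassGroup.extendedHom_surjective_of_conductor (conductor_mul_mem d f)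
    (by exact_mod_cast hf0) (not_isUnit_natCast hd2 hd hf1)

/-- The class number of the order of conductor `ℓ` for a prime divisor `ℓ` of `d` that does not
divide the coefficient `y` of some unit `x + y ω`. -/
theorem orderClassNumber_eq_classNumber (hd2 : 2 ≤ d) (hd : Squarefree d) {ℓ : ℕ} (hℓ : ℓ.Prime)
    (hℓd : ℓ ∣ d) {ε : (maxOrder d)ˣ} {x y : ℤ} (hε : (ε : maxOrder d) = x + y * om d)
    (hy : ¬ (ℓ : ℤ) ∣ y) : orderClassNumber d ℓ = classNumber d := by
  have : Fact ℓ.Prime := ⟨hℓ⟩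
  rw [classNumber_eq, orderClassNumber_eq]
  refine Nat.card_eq_of_bijective _ ⟨?_, extendedHom_order_surjective hd2 hd hℓ.ne_zero hℓ.ne_one⟩
  exact ClassGroup.extendedHom_injective_of_units (conductor_mul_mem d ℓ) (fun a ha => ha)
    (span_rootD_ne_top hd2 hd hℓ hℓd) (Ideal.subset_span (by simp))
    (exists_residue hd2 hd hℓ hℓd hε hy)

theorem units_mem_order (hd2 : 2 ≤ d) (hd : Squarefree d) {ℓ : ℕ} (hℓ : ℓ.Prime)
    {ε : (maxOrder d)ˣ} (hfund : IsFundamentalUnit ε) {x y : ℤ}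
    (hε : (ε : maxOrder d) = x + y * om d) (hy : (ℓ : ℤ) ∣ y) (u : (maxOrder d)ˣ) :
    (u : maxOrder d) ∈ order d ℓ := by
  have h1 : (ε : maxOrder d) ∈ order d ℓ := by rw [hε, mem_order_iff hd2 hd]; exact hy
  have h2 : ((ε⁻¹ : (maxOrder d)ˣ) : maxOrder d) ∈ order d ℓ := by
    obtain ⟨a, b, hab⟩ := exists_coords hd2 hd ((ε⁻¹ : (maxOrder d)ˣ) : maxOrder d)
    rw [hab, mem_order_iff hd2 hd]
    have hmul : ((x : maxOrder d) + y * om d) * (a + b * om d) = 1 := by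
      rw [← hε, ← hab, Units.mul_inv]
    have h0 : ((x * a + omegaConst d * y * b - 1 : ℤ) : maxOrder d) +
        (x * b + y * a + omegaTrace d * y * b : ℤ) * om d = 0 := by
      push_cast
      linear_combination hmul - (y * b : maxOrder d) * om_sq d
    obtain ⟨h3, h4⟩ := coords_eq_zero hd2 hd h0
    have hp := Nat.prime_iff_prime_int.mp hℓ
    have hxb : (ℓ : ℤ) ∣ x * b := by
      have : x * b = - (y * (a + omegaTrace d * b)) := by linarith
      rw [this]
      exact (hy.mul_right _).neg_right
    -- `ℓ` divides `y`, so `ℓ ∣ x` would contradict that the constant coefficient of `ε ε⁻¹` is `1`.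
    refine (hp.dvd_or_dvd hxb).resolve_left fun hx => hp.not_dvd_one ?_
    have : (1 : ℤ) = x * a + y * (omegaConst d * b) := by linarith
    rw [this]
    exact dvd_add (hx.mul_right _) (hy.mul_right _)
  have h3 : ∀ k : ℤ, ((ε ^ k : (maxOrder d)ˣ) : maxOrder d) ∈ order d ℓ := by
    intro k
    obtain ⟨n, rfl | rfl⟩ := k.eq_nat_or_neg
    · rw [zpow_natCast, Units.val_pow_eq_pow_val]; exact pow_mem h1 n
    · rw [zpow_neg, zpow_natCast, ← inv_pow, Units.val_pow_eq_pow_val]; exact pow_mem h2 n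
  obtain ⟨k, rfl | rfl⟩ := hfund.2 u
  · exact h3 k
  · rw [Units.val_neg]; exact neg_mem (h3 k)

theorem order_le_order {f ℓ : ℕ} (h : ℓ ∣ f) : order d f ≤ order d ℓ := by
  obtain ⟨g, rfl⟩ := h
  rintro _ ⟨n, w, rfl⟩
  exact ⟨n, g * w, by push_cast; ring⟩

/-- If all units lie in the order of conductor `ℓ` for a prime divisor `ℓ` of `d` and of `f`, the
class number of the order of conductor `f` is not that of the maximal order. -/
theorem orderClassNumber_ne (hd2 : 2 ≤ d) (hd : Squarefree d) {f ℓ : ℕ} (hf : Squarefree f)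
    (hℓ : ℓ.Prime) (hℓd : ℓ ∣ d) (hℓf : ℓ ∣ f)
    (hu : ∀ u : (maxOrder d)ˣ, (u : maxOrder d) ∈ order d ℓ)
    (h0 : orderClassNumber d f ≠ 0) : classNumber d ≠ orderClassNumber d f := by
  intro heq
  have hfne : f ≠ 1 := by rintro rfl; exact hℓ.one_lt.ne' (Nat.dvd_one.mp hℓf)
  have hsurj := extendedHom_order_surjective hd2 hd hf.ne_zero hfne
  rw [orderClassNumber_eq] at h0
  rw [classNumber_eq, orderClassNumber_eq] at heq
  -- `h0` excludes the value `0` that `Nat.card` gives to an infinite type; between finite sets of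
  -- equal size surjectivity yields injectivity.
  have := Nat.finite_of_card_ne_zero h0
  have hinj := (hsurj.bijective_of_nat_card_le heq.ge).1
  obtain ⟨g, rfl⟩ := hℓf
  have hg : ¬ ℓ ∣ g := by
    rintro ⟨k, rfl⟩
    exact hℓ.one_lt.ne' (Nat.isUnit_iff.mp (hf ℓ ⟨k, by ring⟩))
  -- The norm `1 - g²d` is congruent to `1` modulo `ℓg`, whereas the `ω`-coefficient of `1 + gδ` is
  -- `g` or `2g`, prime to `ℓ`.
  have hcop : IsCoprime (1 + g * rootD d) ((ℓ * g : ℕ) : maxOrder d) := by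
    obtain ⟨e, he⟩ := hℓd
    refine ⟨1 - g * rootD d, g * e, ?_⟩
    have := rootD_mul_self d
    have he' := congrArg (Nat.cast : ℕ → maxOrder d) he
    push_cast at he' ⊢
    linear_combination - (g : maxOrder d) ^ 2 * (this + he')
  obtain ⟨z, hz, v, hv⟩ := ClassGroup.exists_associated_of_extendedHom_injective
    (conductor_mul_mem d (ℓ * g)) (not_isUnit_natCast hd2 hd hfne) hinj hcop
  have hmem : 1 + g * rootD d ∈ order d ℓ :=
    hv ▸ mul_mem (order_le_order (dvd_mul_right ℓ g) hz) (hu v)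
  have hp := Nat.prime_iff_prime_int.mp hℓ
  by_cases h4 : d % 4 = 1
  · have h5 : 1 + g * rootD d = ((1 - g : ℤ) : maxOrder d) + (2 * g : ℤ) * om d := by
      rw [rootD, if_pos h4]; push_cast; ring
    rw [h5, mem_order_iff hd2 hd] at hmem
    have h6 : ℓ ∣ 2 * g := by exact_mod_cast hmem
    rcases hℓ.dvd_mul.mp h6 with h | h
    · have : ℓ = 2 := (Nat.prime_dvd_prime_iff_eq hℓ Nat.prime_two).mp h
      subst this
      omega
    · exact hg h
  · have h5 : 1 + g * rootD d = ((1 : ℤ) : maxOrder d) + (g : ℤ) * om d := by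
      rw [rootD, if_neg h4]; push_cast; ring
    rw [h5, mem_order_iff hd2 hd] at hmem
    exact hg (by exact_mod_cast hmem)

/-! ### Conjugation, norms of principal ideals and the prime above `2`. -/

open scoped NumberTheorySymbols

/-- The nontrivial automorphism of `𝒪_K`. -/
noncomputable def conj (hd2 : 2 ≤ d) (hd : Squarefree d) : maxOrder d →+* maxOrder d :=
  ((quadEquiv hd2 hd).toRingEquiv.toRingHom.comp (starRingEnd _)).comp
    (quadEquiv hd2 hd).symm.toRingEquiv.toRingHom

theorem conj_apply (hd2 : 2 ≤ d) (hd : Squarefree d) (a b : ℤ) :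
    conj hd2 hd (a + b * om d) = a + b * (omegaTrace d - om d) := by
  have h : (quadEquiv hd2 hd).symm (a + b * om d) = ⟨a, b⟩ := by
    rw [AlgEquiv.symm_apply_eq, quadEquiv_apply]
  have h' : conj hd2 hd (a + b * om d) =
    quadEquiv hd2 hd (star ((quadEquiv hd2 hd).symm (a + b * om d))) := rfl
  rw [h', h, quadEquiv_apply]
  simp
  ring

theorem mul_conj (hd2 : 2 ≤ d) (hd : Squarefree d) (a b : ℤ) :
    ((a : maxOrder d) + b * om d) * conj hd2 hd (a + b * om d) =
      (a ^ 2 + omegaTrace d * a * b - omegaConst d * b ^ 2 : ℤ) := by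
  rw [conj_apply]
  push_cast
  linear_combination - (b : maxOrder d) ^ 2 * om_sq d

/-- The norm of a generator of a principal ideal. -/
theorem exists_norm_eq_of_isPrincipal (hd2 : 2 ≤ d) (hd : Squarefree d) {I : Ideal (maxOrder d)}
    {n : ℤ} (hI : I * I.map (conj hd2 hd) = Ideal.span {(n : maxOrder d)}) (hp : I.IsPrincipal) :
    ∃ a b s : ℤ, (s = 1 ∨ s = -1) ∧
      a ^ 2 + omegaTrace d * a * b - omegaConst d * b ^ 2 = s * n := by
  obtain ⟨γ, rfl⟩ := hp
  obtain ⟨a, b, rfl⟩ := exists_coords hd2 hd γ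
  rw [Ideal.submodule_span_eq, Ideal.map_span, Set.image_singleton,
    Ideal.span_singleton_mul_span_singleton, mul_conj, Ideal.span_singleton_eq_span_singleton] at hI
  have h1 := intCast_dvd hd2 hd hI.dvd
  have h2 := intCast_dvd hd2 hd hI.symm.dvd
  obtain ⟨u, hu⟩ := (associated_of_dvd_dvd h2 h1)
  refine ⟨a, b, u, ?_, by rw [← hu]; ring⟩
  rcases Int.units_eq_one_or u with rfl | rfl <;> simp

theorem isPrincipal_mul_of_not_isPrincipal (h : classNumber d = 2) {I J : Ideal (maxOrder d)}
    (hI0 : I ≠ ⊥) (hJ0 : J ≠ ⊥) (hI : ¬ I.IsPrincipal) (hJ : ¬ J.IsPrincipal) :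
    (I * J).IsPrincipal := by
  rw [classNumber_eq] at h
  obtain ⟨z, -, hz⟩ := (Nat.card_eq_two_iff' (1 : ClassGroup (maxOrder d))).mp h
  have hI' := mem_nonZeroDivisors_of_ne_zero hI0
  have hJ' := mem_nonZeroDivisors_of_ne_zero hJ0
  have h1 : ClassGroup.mk0 ⟨I, hI'⟩ ≠ 1 := fun h => hI ((ClassGroup.mk0_eq_one_iff hI').mp h)
  have h2 : ClassGroup.mk0 ⟨J, hJ'⟩ ≠ 1 := fun h => hJ ((ClassGroup.mk0_eq_one_iff hJ').mp h)
  have h3 : (ClassGroup.mk0 ⟨I, hI'⟩)⁻¹ = ClassGroup.mk0 ⟨J, hJ'⟩ :=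
    (hz _ (inv_ne_one.mpr h1)).trans (hz _ h2).symm
  rw [← ClassGroup.mk0_eq_one_iff (mul_mem hI' hJ')]
  change ClassGroup.mk0 (⟨I, hI'⟩ * ⟨J, hJ'⟩) = 1
  rw [map_mul, ← h3, mul_inv_cancel]

/-- The form `≠ -1` covers the case where `X` is not prime to `p`. -/
theorem jacobiSym_ne_neg_one_of_dvd {p : ℕ} {X c : ℤ} (h : (p : ℤ) ∣ X ^ 2 - c) :
    J(c | p) ≠ -1 := by
  have h1 : J(c | p) = J(X ^ 2 | p) :=
    jacobiSym.mod_left' (Int.modEq_iff_dvd.mpr h)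
  rw [h1, jacobiSym.pow_left]
  nlinarith [sq_nonneg J(X | p)]

theorem exists_nonresidue {p : ℕ} (hp : p.Prime) (hp2 : p ≠ 2) : ∃ n : ℕ, J(n | p) = -1 := by
  have : Fact p.Prime := ⟨hp⟩
  obtain ⟨a, ha⟩ := FiniteField.exists_nonsquare (F := ZMod p) (by rwa [ZMod.ringChar_zmod_n])
  refine ⟨a.val, ?_⟩
  rw [← jacobiSym.legendreSym.to_jacobiSym, legendreSym.eq_neg_one_iff]
  simpa using ha

theorem coprime_of_jacobiSym {n p : ℕ} (hp : p ≠ 0) (h : J(n | p) = -1) : n.Coprime p := by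
  have : NeZero p := ⟨hp⟩
  by_contra hcop
  have := (jacobiSym.eq_zero_iff_not_coprime (a := n) (b := p)).mpr (by simpa using hcop)
  omega

/-- A prime that is `1` modulo `4` and a nonresidue modulo two given primes. -/
theorem exists_prime_nonresidue {p q : ℕ} (hp : p.Prime) (hq : q.Prime) (hp2 : p ≠ 2) (hq2 : q ≠ 2)
    (hpq : p ≠ q) (N : ℕ) :
    ∃ r > N, r.Prime ∧ r % 4 = 1 ∧ J(r | p) = -1 ∧ J(r | q) = -1 := by
  obtain ⟨n₁, h₁⟩ := exists_nonresidue hp hp2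
  obtain ⟨n₂, h₂⟩ := exists_nonresidue hq hq2
  have hcpq : p.Coprime q := (Nat.coprime_primes hp hq).mpr hpq
  have hc4 : Nat.Coprime 4 (p * q) := by
    have h2p : Nat.Coprime 2 p := (Nat.coprime_primes Nat.prime_two hp).mpr hp2.symm
    have h2q : Nat.Coprime 2 q := (Nat.coprime_primes Nat.prime_two hq).mpr hq2.symm
    exact (Nat.Coprime.mul_right h2p h2q).pow_left 2
  obtain ⟨k, hkp, hkq⟩ := Nat.chineseRemainder hcpq n₁ n₂
  obtain ⟨n, hn4, hnk⟩ := Nat.chineseRemainder hc4 1 k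
  have hnp : n ≡ n₁ [MOD p] := (hnk.of_mul_right q).trans hkp
  have hnq : n ≡ n₂ [MOD q] := (hnk.of_mul_left p).trans hkq
  have hJ {a b m : ℕ} (h : a ≡ b [MOD m]) (hb : J(b | m) = -1) : J(a | m) = -1 := by
    rw [← hb]
    exact jacobiSym.mod_left' (by exact_mod_cast h)
  have hcop : n.Coprime (4 * (p * q)) := by
    refine Nat.Coprime.mul_right ?_ (Nat.Coprime.mul_right ?_ ?_)
    · have : n % 4 = 1 := hn4
      have : Nat.Coprime n 2 := (Nat.coprime_two_right).mpr (Nat.odd_iff.mpr (by omega))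
      exact this.pow_right 2
    · exact coprime_of_jacobiSym hp.ne_zero (hJ hnp h₁)
    · exact coprime_of_jacobiSym hq.ne_zero (hJ hnq h₂)
  have : NeZero (4 * (p * q)) := ⟨by have := hp.ne_zero; have := hq.ne_zero; positivity⟩
  -- Dirichlet's theorem on primes in arithmetic progressions.
  obtain ⟨r, hrN, hr, hrn⟩ := Nat.forall_exists_prime_gt_and_eq_mod
    ((ZMod.isUnit_iff_coprime n (4 * (p * q))).mpr hcop) N
  have hrn' : r ≡ n [MOD 4 * (p * q)] := (ZMod.natCast_eq_natCast_iff _ _ _).mp hrn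
  exact ⟨r, hrN, hr, (hrn'.of_mul_right _).trans hn4,
    hJ ((hrn'.of_mul_left 4).of_mul_right q) (hJ hnp h₁),
    hJ ((hrn'.of_mul_left 4).of_mul_left p) (hJ hnq h₂)⟩

/-- Used to compute the product of an ideal with its conjugate. -/
theorem span_pair_mul_span_pair_eq {R : Type*} [CommRing R] {x y y' n : R} (hn : n ∣ x)
    (hy : n ∣ y * y')
    (h : ∃ a b c e : R, n = a * (x * x) + b * (x * y') + c * (y * x) + e * (y * y')) :
    Ideal.span {x, y} * Ideal.span {x, y'} = Ideal.span {n} := by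
  rw [Ideal.span_pair_mul_span_pair]
  apply le_antisymm
  · rw [Ideal.span_le]
    rintro z (rfl | rfl | rfl | rfl)
    · exact Ideal.mem_span_singleton.mpr (hn.mul_right _)
    · exact Ideal.mem_span_singleton.mpr (hn.mul_right _)
    · exact Ideal.mem_span_singleton.mpr (hn.mul_left _)
    · exact Ideal.mem_span_singleton.mpr hy
  · rw [Ideal.span_singleton_le_iff_mem]
    obtain ⟨a, b, c, e, h⟩ := h
    rw [h]
    refine add_mem (add_mem (add_mem ?_ ?_) ?_) ?_ <;>
    exact Ideal.mul_mem_left _ _ (Ideal.subset_span (by simp))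

/-- If the class number is two and `d = pq` with `p ≡ 1 mod 8` and `q ≡ 3 mod 4`, the prime ideal
above `2` is principal. -/
theorem exists_sq_sub_mul_sq_eq_two (hd2 : 2 ≤ d) (hd : Squarefree d) (hh : classNumber d = 2)
    {p q : ℕ} (hp : p.Prime) (hq : q.Prime) (hp8 : p % 8 = 1) (hq4 : q % 4 = 3) (hpq : d = p * q) :
    ∃ a b s : ℤ, (s = 1 ∨ s = -1) ∧ a ^ 2 - d * b ^ 2 = s * 2 := by
  have hd4 : d % 4 = 3 := by
    rw [hpq, Nat.mul_mod, hq4, show p % 4 = 1 by omega]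
  have hT : omegaTrace d = 0 := if_neg (by omega)
  have hC : omegaConst d = d := if_neg (by omega)
  have hom := om_sq d
  rw [hT, hC] at hom
  have hconj (a b : ℤ) := conj_apply hd2 hd a b
  rw [hT] at hconj
  have hnorm {I : Ideal (maxOrder d)} {n : ℤ}
      (hI : I * I.map (conj hd2 hd) = Ideal.span {(n : maxOrder d)}) (hpr : I.IsPrincipal) :
      ∃ a b s : ℤ, (s = 1 ∨ s = -1) ∧ a ^ 2 - d * b ^ 2 = s * n := by
    simpa [hT, hC] using exists_norm_eq_of_isPrincipal hd2 hd hI hpr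
  -- By reciprocity `r` splits, since its two symbols `-1` multiply to `1`. A prime above it is not
  -- principal: `±r` is not a square modulo `p`. If the prime above `2` were not principal either,
  -- their product would be, and `±2r` would be a square modulo `p`, although `-1` and `2` are.
  obtain ⟨r, hrd, hr, hr4, hrp, hrq⟩ := exists_prime_nonresidue hp hq (by omega) (by omega)
    (by rintro rfl; omega) d
  have hJd : J(d | r) = 1 := by
    rw [hpq, Nat.cast_mul, jacobiSym.mul_left,
      ← jacobiSym.quadratic_reciprocity_one_mod_four hr4 (Nat.odd_iff.mpr (by omega)),
      ← jacobiSym.quadratic_reciprocity_one_mod_four hr4 (Nat.odd_iff.mpr (by omega)), hrp, hrq]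
    norm_num
  have : Fact r.Prime := ⟨hr⟩
  have hrd' : ¬ r ∣ d := fun h => by have := Nat.le_of_dvd (by omega) h; omega
  obtain ⟨s, hs⟩ : ∃ s : ℤ, (r : ℤ) ∣ s ^ 2 - d := by
    rw [← jacobiSym.legendreSym.to_jacobiSym, legendreSym.eq_one_iff] at hJd
    · obtain ⟨c, hc⟩ := hJd
      obtain ⟨s, rfl⟩ := ZMod.intCast_surjective c
      refine ⟨s, (ZMod.intCast_zmod_eq_zero_iff_dvd _ _).mp ?_⟩
      push_cast at hc ⊢
      rw [hc]; ring
    · simpa [ZMod.natCast_eq_zero_iff] using hrd'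
  have hrs : IsCoprime (r : ℤ) (2 * s) := by
    have hrp' := Nat.prime_iff_prime_int.mp hr
    refine hrp'.irreducible.coprime_iff_not_dvd.mpr fun h => ?_
    rcases hrp'.dvd_or_dvd h with h | h
    · have : r ∣ 2 := by exact_mod_cast h
      have := Nat.le_of_dvd two_pos this
      have := hr.two_le
      omega
    · apply hrd'
      have h1 : (r : ℤ) ∣ s ^ 2 := Dvd.dvd.pow h two_ne_zero
      have : (r : ℤ) ∣ d := by simpa using dvd_sub h1 hs
      exact_mod_cast this
  set I : Ideal (maxOrder d) := Ideal.span {2, 1 + om d} with hI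
  set R : Ideal (maxOrder d) := Ideal.span {(r : maxOrder d), s - om d} with hR
  have hIconj : I.map (conj hd2 hd) = Ideal.span {2, 1 - om d} := by
    have := hconj 1 1
    simp only [Int.cast_one, Int.cast_zero, one_mul, zero_sub] at this
    rw [hI, Ideal.map_span, Set.image_pair, map_ofNat, this, ← sub_eq_add_neg]
  have hRconj : R.map (conj hd2 hd) = Ideal.span {(r : maxOrder d), s + om d} := by
    have := hconj s (-1)
    have h' : (s : maxOrder d) - om d = s + (-1 : ℤ) * om d := by push_cast; ring
    rw [hR, Ideal.map_span, Set.image_pair, map_natCast, h', this]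
    congr 3
    push_cast; ring
  have hI2 : I * I.map (conj hd2 hd) = Ideal.span {((2 : ℤ) : maxOrder d)} := by
    rw [hIconj, hI]
    obtain ⟨k, hk⟩ : ∃ k : ℕ, d = 4 * k + 3 := ⟨d / 4, by omega⟩
    have hk' : (d : maxOrder d) = 4 * k + 3 := by exact_mod_cast congrArg (Nat.cast) hk
    refine span_pair_mul_span_pair_eq (by simp) ⟨- (2 * k + 1), ?_⟩
      ⟨k + 1, 0, 0, 1, ?_⟩
    · push_cast at hom ⊢
      linear_combination - hom - hk'
    · push_cast at hom ⊢
      linear_combination hom + hk'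
  have hR2 : R * R.map (conj hd2 hd) = Ideal.span {((r : ℤ) : maxOrder d)} := by
    rw [hRconj, hR]
    obtain ⟨e, he⟩ := hs
    obtain ⟨u, v, huv⟩ := hrs
    have he' := congrArg (Int.cast : ℤ → maxOrder d) he
    have huv' := congrArg (Int.cast : ℤ → maxOrder d) huv
    push_cast at he' huv' hom
    refine span_pair_mul_span_pair_eq (by simp) ⟨e, ?_⟩ ⟨u, v, v, 0, ?_⟩
    · push_cast
      linear_combination he' - hom
    · push_cast
      linear_combination (-r : maxOrder d) * huv'
  have hI0 : I ≠ ⊥ := fun h => two_ne_zero (α := maxOrder d)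
    (Ideal.mem_bot.mp (h ▸ Ideal.subset_span (by simp)))
  have hR0 : R ≠ ⊥ := fun h => hr.ne_zero (by
    exact_mod_cast (Ideal.mem_bot.mp (h ▸ Ideal.subset_span (by simp)) : (r : maxOrder d) = 0))
  have hJneg : J(-1 | p) = 1 := by
    rw [jacobiSym.at_neg_one (Nat.odd_iff.mpr (by omega)), ZMod.χ₄_nat_one_mod_four (by omega)]
  have hJtwo : J(2 | p) = 1 := by
    rw [jacobiSym.at_two (Nat.odd_iff.mpr (by omega)), ZMod.χ₈_nat_eq_if_mod_eight]
    simp [hp8, show p % 2 = 1 by omega]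
  have hpd (a b c : ℤ) (h : a ^ 2 - d * b ^ 2 = c) : (p : ℤ) ∣ a ^ 2 - c := by
    rw [← h, hpq]; exact ⟨q * b ^ 2, by push_cast; ring⟩
  by_contra hcon
  have hInp : ¬ I.IsPrincipal := fun h => hcon (hnorm hI2 h)
  have hRnp : ¬ R.IsPrincipal := by
    intro h
    obtain ⟨a, b, t, ht, hab⟩ := hnorm hR2 h
    refine jacobiSym_ne_neg_one_of_dvd (hpd _ _ _ hab) ?_
    rcases ht with rfl | rfl <;> rw [jacobiSym.mul_left, hrp] <;> simp [hJneg]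
  have hIR := isPrincipal_mul_of_not_isPrincipal hh hI0 hR0 hInp hRnp
  obtain ⟨a, b, t, ht, hab⟩ := hnorm (n := 2 * r) (by
    rw [Ideal.map_mul, mul_mul_mul_comm, hI2, hR2, Ideal.span_singleton_mul_span_singleton]
    push_cast; rfl) hIR
  refine jacobiSym_ne_neg_one_of_dvd (hpd _ _ _ hab) ?_
  rcases ht with rfl | rfl <;> rw [jacobiSym.mul_left, jacobiSym.mul_left, hrp, hJtwo] <;>
    simp [hJneg]


/-! ### Ramified primes and square roots of `n ε`. -/

theorem isRamified_iff {p : ℕ} : IsRamified d p ↔ p.Prime ∧ (p : ℤ) ∣ disc d := by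
  refine and_congr_right fun hp => ?_
  unfold kronecker
  split_ifs with h2
  · subst h2
    rw [ZMod.χ₈_int_eq_if_mod_eight]
    split_ifs <;> simp <;> omega
  · have : NeZero p := ⟨hp.ne_zero⟩
    rw [jacobiSym.eq_zero_iff_not_coprime, Int.gcd_comm, Ne, ← Int.isCoprime_iff_gcd_eq_one,
      (Nat.prime_iff_prime_int.mp hp).irreducible.coprime_iff_not_dvd, not_not]

theorem dvd_disc_of_dvd {p : ℕ} (h : p ∣ d) : (p : ℤ) ∣ disc d := by
  have h' : (p : ℤ) ∣ d := by exact_mod_cast h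
  unfold disc
  split_ifs
  · exact h'
  · exact h'.mul_left 4

/-- If the class number of the order of conductor `ℓ` is two and the prime ideal above `ℓ` is
not principal, `ℓ` is an unusual conductor. -/
theorem mem_unusualConductors {ℓ : ℕ} (hℓ : ℓ.Prime) (hℓd : ℓ ∣ d)
    (h1 : orderClassNumber d ℓ = classNumber d) (hh : classNumber d = 2)
    (h2 : ∀ a b : ℤ, |(ℓ : ℤ) * a ^ 2 - disc d / (ℓ : ℤ) * b ^ 2| ≠ 4) :
    ℓ ∈ unusualConductors d := by
  have hram : IsRamified d ℓ := isRamified_iff.mpr ⟨hℓ, dvd_disc_of_dvd hℓd⟩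
  refine ⟨hℓ.pos, hℓ.squarefree, ⟨ℓ, hram, dvd_rfl⟩, ?_, h1.symm, h1.trans hh, ?_⟩
  · intro p hp hpℓ
    rw [(Nat.prime_dvd_prime_iff_eq hp.1 hℓ).mp hpℓ] at hp
    have := hp.2.symm.trans hram.2
    omega
  · intro p hp hpℓ
    rwa [(Nat.prime_dvd_prime_iff_eq hp.1 hℓ).mp hpℓ]

/-- The hypothesis says that `α` has trace `na` and norm `ns`. The inverse of `aα - s` is its
conjugate, obtained by replacing `α` with `na - α`. -/
theorem exists_unit_of_mul_self {R : Type*} [CommRing R] {α n a s : R}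
    (h : α * α = n * (a * α - s)) (hs : s * s = 1) : ∃ u : Rˣ, α * α = n * u :=
  ⟨Units.mkOfMulEqOne (a * α - s) (a * (n * a - α) - s) (by
    linear_combination hs - a ^ 2 * h), h⟩

/-- Up to powers of the fundamental unit, an element whose square is associated to a positive
integer `n` is a square root of `n` or of `n ε`. -/
theorem exists_mul_self_eq {ε : (maxOrder d)ˣ} (hfund : IsFundamentalUnit ε) {n : ℕ} (hn : 0 < n)
    {α : maxOrder d} {u : (maxOrder d)ˣ} (h : α * α = n * u) :
    ∃ γ : maxOrder d, γ * γ = n ∨ γ * γ = n * ε := by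
  have hpos : ∀ k : ℤ, 0 < toRealHom d ((ε ^ k : (maxOrder d)ˣ) : maxOrder d) := by
    intro k
    have h2 : toRealHom d ((ε ^ k : (maxOrder d)ˣ) : maxOrder d) = toRealHom d ε ^ k := by
      have h3 : Units.map (toRealHom d : maxOrder d →* ℝ) (ε ^ k) =
        (Units.map (toRealHom d : maxOrder d →* ℝ) ε) ^ k := map_zpow _ _ _
      have h4 := congrArg Units.val h3
      rw [Units.val_zpow_eq_zpow_val] at h4
      exact h4
    rw [h2]
    exact zpow_pos (one_pos.trans hfund.1) k
  obtain ⟨k, rfl | rfl⟩ := hfund.2 u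
  · obtain ⟨j, rfl | rfl⟩ := k.even_or_odd'
    · refine ⟨α * (ε ^ (-j) : (maxOrder d)ˣ), Or.inl ?_⟩
      have h1 : (((ε ^ (2 * j) * (ε ^ (-j) * ε ^ (-j)) : (maxOrder d)ˣ)) : maxOrder d) = 1 := by
        rw [← zpow_add, ← zpow_add, show 2 * j + (-j + -j) = 0 by ring, zpow_zero, Units.val_one]
      push_cast at h1
      linear_combination ((ε ^ (-j) : (maxOrder d)ˣ) : maxOrder d) ^ 2 * h + n * h1
    · refine ⟨α * (ε ^ (-j) : (maxOrder d)ˣ), Or.inr ?_⟩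
      have h1 : (((ε ^ (2 * j + 1) * (ε ^ (-j) * ε ^ (-j)) : (maxOrder d)ˣ)) : maxOrder d) = ε := by
        rw [← zpow_add, ← zpow_add, show 2 * j + 1 + (-j + -j) = 1 by ring, zpow_one]
      push_cast at h1
      linear_combination ((ε ^ (-j) : (maxOrder d)ˣ) : maxOrder d) ^ 2 * h + n * h1
  -- A square is nonnegative in `ℝ`, while `n` and all powers of `ε` are positive.
  · exfalso
    have h1 := congrArg (toRealHom d) h
    rw [map_mul, map_mul, map_natCast, Units.val_neg, map_neg] at h1
    have h2 : (0 : ℝ) < n * toRealHom d ((ε ^ k : (maxOrder d)ˣ) : maxOrder d) :=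
      mul_pos (by exact_mod_cast hn) (hpos k)
    nlinarith [mul_self_nonneg (toRealHom d α)]

/-- A square root of `n` in `K` is rational or a rational multiple of `√d`. The first makes `n` a
square, the second makes the odd prime `q` divide `n`. -/
theorem mul_self_ne_natCast (hd2 : 2 ≤ d) (hd : Squarefree d) {n q : ℕ} (hn : Squarefree n)
    (hn1 : n ≠ 1) (hq : q.Prime) (hq2 : q ≠ 2) (hqd : q ∣ d) (hqn : ¬ q ∣ n) (γ : maxOrder d) :
    γ * γ ≠ n := by
  obtain ⟨a, b, rfl⟩ := exists_coords hd2 hd γ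
  intro h
  have h0 : ((a ^ 2 + omegaConst d * b ^ 2 - n : ℤ) : maxOrder d) +
      (b * (2 * a + omegaTrace d * b) : ℤ) * om d = 0 := by
    push_cast
    linear_combination h - (b : maxOrder d) ^ 2 * om_sq d
  obtain ⟨h1, h2⟩ := coords_eq_zero hd2 hd h0
  have hT := omegaTrace_sq_add d
  rcases mul_eq_zero.mp h2 with rfl | h3
  · have h4 : (n : ℤ) = a * a := by linarith
    have h5 : n = a.natAbs * a.natAbs := by
      rw [← Int.natAbs_mul, ← h4, Int.natAbs_natCast]
    have h6 := Nat.isUnit_iff.mp (hn a.natAbs (Dvd.intro_left 1 (by rw [one_mul, ← h5])))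
    rw [h6] at h5
    exact hn1 h5
  · have h4 : 4 * (n : ℤ) = disc d * b ^ 2 := by
      rw [← hT]; linear_combination -4 * h1 + (2 * a - omegaTrace d * b) * h3
    have hq' := Nat.prime_iff_prime_int.mp hq
    have h5 : (q : ℤ) ∣ 4 * n := h4 ▸ (dvd_disc_of_dvd hqd).mul_right _
    rcases hq'.dvd_or_dvd h5 with h6 | h6
    · have h7 : q ∣ 2 ^ 2 := by exact_mod_cast h6
      exact hq2 ((Nat.prime_dvd_prime_iff_eq hq Nat.prime_two).mp (hq.dvd_of_dvd_pow h7))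
    · exact hqn (by exact_mod_cast h6)

theorem exists_sign_of_abs_eq_four (z : ℤ) (h : |z| = 4) :
    ∃ s : ℤ, (s = 1 ∨ s = -1) ∧ z = 4 * s := by
  rcases (abs_eq (by norm_num)).mp h with h | h
  · exact ⟨1, Or.inl rfl, by omega⟩
  · exact ⟨-1, Or.inr rfl, by omega⟩

/-- When `d ≢ 1 mod 4`, the condition on `d = p e` for `p` to be an unusual conductor. -/
theorem exists_of_abs_eq_four {p e : ℕ} (hp : p.Prime) (hp2 : p ≠ 2) (hd : d = p * e)
    (hd4 : d % 4 ≠ 1) {a b : ℤ} (h : |(p : ℤ) * a ^ 2 - disc d / (p : ℤ) * b ^ 2| = 4) :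
    ∃ a s : ℤ, (s = 1 ∨ s = -1) ∧ p * a ^ 2 - e * b ^ 2 = s := by
  obtain ⟨s, hs, h⟩ := exists_sign_of_abs_eq_four _ h
  have hdiv : disc d / (p : ℤ) = 4 * e := by
    rw [disc, if_neg hd4, hd]
    exact Int.ediv_eq_of_eq_mul_right (by exact_mod_cast hp.ne_zero) (by push_cast; ring)
  rw [hdiv] at h
  -- Since `disc d / p = 4e`, the number `p a²` is a multiple of `4`.
  have ha : Even a := by
    by_contra ha
    rw [Int.not_even_iff_odd] at ha
    have hpo : Odd (p : ℤ) := by exact_mod_cast hp.odd_of_ne_two hp2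
    have hodd : Odd ((p : ℤ) * a ^ 2) := hpo.mul ha.pow
    have : (p : ℤ) * a ^ 2 = 4 * (s + e * b ^ 2) := by linarith
    rw [this] at hodd
    exact (Int.not_odd_iff_even.mpr ⟨2 * (s + e * b ^ 2), by ring⟩) hodd
  obtain ⟨c, rfl⟩ := ha
  exact ⟨c, s, hs, by linarith⟩

theorem abs_ne_four_of_norm_eq_neg_one (hd2 : 2 ≤ d) (hd : Squarefree d)
    {ε : (maxOrder d)ˣ} (hfund : IsFundamentalUnit ε)
    (hN : Algebra.norm ℚ ((ε : maxOrder d) : quadField d) = -1) {p q : ℕ} (hp : p.Prime)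
    (hq : q.Prime) (hpq : p ≠ q) (hp4 : p % 4 = 1) (hq4 : q % 4 = 1) (hdpq : d = p * q) (a b : ℤ) :
    |(p : ℤ) * a ^ 2 - disc d / (p : ℤ) * b ^ 2| ≠ 4 := by
  intro h
  obtain ⟨s, hs, h⟩ := exists_sign_of_abs_eq_four _ h
  have hd4 : d % 4 = 1 := by rw [hdpq, Nat.mul_mod, hp4, hq4]
  have hdiv : disc d / (p : ℤ) = q := by
    rw [disc, if_pos hd4, hdpq]
    exact Int.ediv_eq_of_eq_mul_right (by exact_mod_cast hp.ne_zero) (by push_cast; ring)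
  rw [hdiv] at h
  have hpar : (p * a - b) % 2 = 0 := by
    have h1 : Even ((p : ℤ) * a ^ 2 - q * b ^ 2) := ⟨2 * s, by rw [h]; ring⟩
    have hpo : ¬ Even (p : ℤ) := by rw [Int.even_iff]; omega
    have hqo : ¬ Even (q : ℤ) := by rw [Int.even_iff]; omega
    rw [← Int.even_iff]
    simpa [Int.even_sub, Int.even_mul, Int.even_pow, hpo, hqo] using h1
  obtain ⟨c, hc⟩ : ∃ c : ℤ, p * a - b = 2 * c := ⟨(p * a - b) / 2, by omega⟩
  have hC : 4 * omegaConst d = d - 1 := by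
    rw [omegaConst, if_pos hd4]; omega
  have hT : omegaTrace d = 1 := if_pos hd4
  have hss : (s : maxOrder d) * s = 1 := by rcases hs with rfl | rfl <;> norm_num
  have hom := om_sq d
  rw [hT] at hom
  -- This element is `(pa + b√d) / 2`, of norm `ps` and trace `pa`.
  have hα : ((c : maxOrder d) + b * om d) * (c + b * om d) = p * (a * (c + b * om d) - s) := by
    have h1 : (c : ℤ) ^ 2 + omegaConst d * b ^ 2 = p * (a * c - s) := by
      have : 4 * (c ^ 2 + omegaConst d * b ^ 2) = 4 * (p * (a * c - s)) := by
        have hb : b = p * a - 2 * c := by linarith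
        have hd' : (d : ℤ) = p * q := by exact_mod_cast hdpq
        linear_combination b ^ 2 * hC + b ^ 2 * hd' - p * h + (b + p * a - 2 * c) * hc
      linarith
    have h1' := congrArg (Int.cast : ℤ → maxOrder d) h1
    have hc' := congrArg (Int.cast : ℤ → maxOrder d) hc
    push_cast at h1' hc' hom
    linear_combination h1' + b ^ 2 * hom - b * om d * hc'
  obtain ⟨u, hu⟩ := exists_unit_of_mul_self hα hss
  obtain ⟨γ, hγ | hγ⟩ := exists_mul_self_eq hfund hp.pos hu
  · refine mul_self_ne_natCast hd2 hd hp.squarefree hp.ne_one hq (by rintro rfl; omega)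
      (hdpq ▸ dvd_mul_left q p) (fun h => hpq ((Nat.prime_dvd_prime_iff_eq hq hp).mp h).symm) γ hγ
  -- Norms turn `γ² = pε` into a square equal to minus a power of `p`.
  · have h1 := congrArg (fun z : maxOrder d => Algebra.norm ℚ (z : quadField d)) hγ
    simp only [map_mul, map_natCast, hN] at h1
    have h2 : Algebra.norm ℚ ((p : ℕ) : quadField d) =
        (p : ℚ) ^ Module.finrank ℚ (quadField d) := by
      simpa using Algebra.norm_algebraMap (S := quadField d) (p : ℚ)
    rw [h2] at h1
    have h3 : (0 : ℚ) < (p : ℚ) ^ Module.finrank ℚ (quadField d) :=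
      pow_pos (by exact_mod_cast hp.pos) _
    nlinarith [mul_self_nonneg (Algebra.norm ℚ (γ : quadField d))]

/-- A solution makes `pε` a square and the principal prime above `2` makes `2ε` one; dividing the
product by `ε²` makes `2p` a square, which the prime `q` forbids. -/
theorem abs_ne_four_of_sq_sub_mul_sq (hd2 : 2 ≤ d) (hd : Squarefree d)
    {ε : (maxOrder d)ˣ} (hfund : IsFundamentalUnit ε) {p q : ℕ} (hp : p.Prime)
    (hq : q.Prime) (hp2 : p ≠ 2) (hq2 : q ≠ 2) (hpq : p ≠ q) (hdpq : d = p * q) (hd4 : d % 4 ≠ 1)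
    (htwo : ∃ a b s : ℤ, (s = 1 ∨ s = -1) ∧ a ^ 2 - d * b ^ 2 = s * 2) (a b : ℤ) :
    |(p : ℤ) * a ^ 2 - disc d / (p : ℤ) * b ^ 2| ≠ 4 := by
  intro h
  obtain ⟨a, s, hs, h⟩ := exists_of_abs_eq_four hp hp2 hdpq hd4 h
  obtain ⟨a', b', s', hs', h'⟩ := htwo
  have hC : omegaConst d = d := if_neg hd4
  have hT : omegaTrace d = 0 := if_neg hd4
  have hom := om_sq d
  rw [hT, hC] at hom
  have hqp : ¬ q ∣ p := fun h => hpq ((Nat.prime_dvd_prime_iff_eq hq hp).mp h).symm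
  have hqtwo : ¬ q ∣ 2 := fun h => hq2 ((Nat.prime_dvd_prime_iff_eq hq Nat.prime_two).mp h)
  have hqd : q ∣ d := hdpq ▸ dvd_mul_left q p
  have hss : (s : maxOrder d) * s = 1 := by rcases hs with rfl | rfl <;> norm_num
  have hss' : (s' : maxOrder d) * s' = 1 := by rcases hs' with rfl | rfl <;> norm_num
  have hd' := congrArg (Nat.cast : ℕ → maxOrder d) hdpq
  have hi := congrArg (Int.cast : ℤ → maxOrder d) h
  have hi' := congrArg (Int.cast : ℤ → maxOrder d) h'
  push_cast at hom hd' hi hi'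
  have hα : ((p * a : maxOrder d) + b * om d) * (p * a + b * om d) =
      p * ((2 * a) * (p * a + b * om d) - s) := by
    linear_combination (b : maxOrder d) ^ 2 * hom + (b : maxOrder d) ^ 2 * hd' - p * hi
  have hβ : ((a' : maxOrder d) + b' * om d) * (a' + b' * om d) =
      (2 : ℕ) * (a' * (a' + b' * om d) - s') := by
    push_cast
    linear_combination (b' : maxOrder d) ^ 2 * hom - hi'
  obtain ⟨u, hu⟩ := exists_unit_of_mul_self hα hss
  obtain ⟨u', hu'⟩ := exists_unit_of_mul_self hβ hss'
  obtain ⟨γ, hγ | hγ⟩ := exists_mul_self_eq hfund hp.pos hu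
  · exact mul_self_ne_natCast hd2 hd hp.squarefree hp.ne_one hq hq2 hqd hqp γ hγ
  obtain ⟨γ', hγ' | hγ'⟩ := exists_mul_self_eq hfund two_pos hu'
  · exact mul_self_ne_natCast hd2 hd Nat.prime_two.squarefree (by norm_num) hq hq2 hqd hqtwo γ' hγ'
  · refine mul_self_ne_natCast hd2 hd (n := p * 2) (q := q)
      ((Nat.squarefree_mul ((Nat.coprime_primes hp Nat.prime_two).mpr hp2)).mpr
        ⟨hp.squarefree, Nat.prime_two.squarefree⟩) (by have := hp.two_le; omega) hq hq2 hqd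
      (fun h => (hq.dvd_mul.mp h).elim hqp hqtwo)
      (γ * γ' * (ε⁻¹ : (maxOrder d)ˣ)) ?_
    have h1 : (ε : maxOrder d) * (ε⁻¹ : (maxOrder d)ˣ) = 1 := Units.mul_inv ε
    push_cast at hγ' ⊢
    linear_combination (γ' * γ' * (ε⁻¹ : (maxOrder d)ˣ) ^ 2) * hγ +
      (p * ε * (ε⁻¹ : (maxOrder d)ˣ) ^ 2) * hγ' +
      2 * p * (1 + (ε : maxOrder d) * (ε⁻¹ : (maxOrder d)ˣ)) * h1

/-! ### Excluding the norm equation by residue symbols. -/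

theorem jacobiSym_ne_neg_one_of_dvd_mul_sq_sub {n : ℕ} {c x s : ℤ} (h : (n : ℤ) ∣ c * x ^ 2 - s) :
    J(c * s | n) ≠ -1 := by
  apply jacobiSym_ne_neg_one_of_dvd (X := c * x)
  have := h.mul_left c
  rwa [show c * (c * x ^ 2 - s) = (c * x) ^ 2 - c * s by ring] at this

theorem jacobiSym_neg_one_of_mod_four_eq_three {q : ℕ} (hq : q % 4 = 3) : J(-1 | q) = -1 := by
  rw [jacobiSym.at_neg_one (Nat.odd_iff.mpr (by omega)), ZMod.χ₄_nat_three_mod_four hq]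

/-- Reduction modulo `q` and modulo `p` constrains `J(p | q)` and `J(q | p)` to have the sign `s`,
because `-1` is a nonresidue and `-2` is a residue modulo `p`; reciprocity gives them opposite
signs. -/
theorem mul_sq_sub_ne_of_mod_eight_eq_three {p q : ℕ} (hp : p.Prime) (hq : q.Prime) (hpq : p ≠ q)
    (hp8 : p % 8 = 3) (hq8 : q % 8 = 3) (a b s : ℤ) (hs : s = 1 ∨ s = -1) :
    (p : ℤ) * a ^ 2 - (2 * q : ℕ) * b ^ 2 ≠ s := by
  intro h
  have h1 : (q : ℤ) ∣ p * a ^ 2 - s := ⟨2 * b ^ 2, by rw [← h]; push_cast; ring⟩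
  have h2 : (p : ℤ) ∣ (-2 * q) * b ^ 2 - s := ⟨-a ^ 2, by rw [← h]; push_cast; ring⟩
  have h3 := jacobiSym_ne_neg_one_of_dvd_mul_sq_sub h1
  have h4 := jacobiSym_ne_neg_one_of_dvd_mul_sq_sub h2
  have hneg : J(-2 | p) = 1 := by
    rw [jacobiSym.at_neg_two (Nat.odd_iff.mpr (by omega)), ZMod.χ₈'_nat_eq_if_mod_eight]
    simp [hp8, show p % 2 = 1 by omega]
  have hrec := jacobiSym.quadratic_reciprocity_three_mod_four (a := p) (b := q)
    (by omega) (by omega)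
  have hne : J(q | p) ≠ 0 := by
    refine jacobiSym.ne_zero ?_
    simpa using (Nat.coprime_primes hq hp).mpr hpq.symm
  rw [jacobiSym.mul_left, hrec] at h3
  rw [jacobiSym.mul_left, jacobiSym.mul_left, hneg] at h4
  have hp1 := jacobiSym_neg_one_of_mod_four_eq_three (q := p) (by omega)
  have hq1 := jacobiSym_neg_one_of_mod_four_eq_three (q := q) (by omega)
  rcases jacobiSym.trichotomy q p with h0 | h0 | h0
  · exact hne h0
  all_goals
    rw [h0] at h3 h4
    rcases hs with rfl | rfl <;> simp_all [jacobiSym.one_left]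

/-- The residue symbols of `-1` and `2` modulo `p ≡ 1 mod 8`. -/
theorem jacobiSym_of_mod_eight_eq_one {p : ℕ} (hp8 : p % 8 = 1) : J(-1 | p) = 1 ∧ J(2 | p) = 1 := by
  constructor
  · rw [jacobiSym.at_neg_one (Nat.odd_iff.mpr (by omega)), ZMod.χ₄_nat_one_mod_four (by omega)]
  · rw [jacobiSym.at_two (Nat.odd_iff.mpr (by omega)), ZMod.χ₈_nat_eq_if_mod_eight]
    simp [hp8, show p % 2 = 1 by omega]

theorem not_dvd_mul_sq_sub_of_mod_eight_eq_one {p : ℕ} (hp8 : p % 8 = 1) {c x s : ℤ}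
    (hc : J(c | p) = -1) (hs : s = 1 ∨ s = -1) : ¬ (p : ℤ) ∣ c * x ^ 2 - s := by
  intro h
  apply jacobiSym_ne_neg_one_of_dvd_mul_sq_sub h
  rw [jacobiSym.mul_left, hc]
  rcases hs with rfl | rfl
  · simp
  · simp [(jacobiSym_of_mod_eight_eq_one hp8).1]

/-! ### Coefficients of units and the vanishing of the set of unusual conductors. -/

theorem norm_unit (hd2 : 2 ≤ d) (hd : Squarefree d) {ε : (maxOrder d)ˣ} {x y : ℤ}
    (hε : (ε : maxOrder d) = x + y * om d) : ∃ s : ℤ, (s = 1 ∨ s = -1) ∧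
      x ^ 2 + omegaTrace d * x * y - omegaConst d * y ^ 2 = s := by
  refine ⟨_, ?_, rfl⟩
  have h := mul_conj hd2 hd x y
  rw [← hε] at h
  have hu : IsUnit ((x ^ 2 + omegaTrace d * x * y - omegaConst d * y ^ 2 : ℤ) : maxOrder d) :=
    h ▸ ε.isUnit.mul (ε.isUnit.map (conj hd2 hd))
  have h1 := intCast_dvd hd2 hd (m := x ^ 2 + omegaTrace d * x * y - omegaConst d * y ^ 2) (n := 1)
    (by rw [Int.cast_one]; exact hu.dvd)
  exact Int.isUnit_iff.mp (isUnit_of_dvd_one h1)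

/-- The coefficient `y` of a unit `x + y √d` is even if `d` is even and has a prime divisor
`q ≡ 3 mod 4`. -/
theorem even_of_unit (hd2 : 2 ≤ d) (hd : Squarefree d) {ε : (maxOrder d)ˣ} {x y : ℤ}
    (hε : (ε : maxOrder d) = x + y * om d) (hd4 : d % 4 = 2) {q : ℕ} (hq4 : q % 4 = 3)
    (hqd : q ∣ d) : Even y := by
  obtain ⟨s, hs, h⟩ := norm_unit hd2 hd hε
  rw [omegaTrace, omegaConst, if_neg (by omega), if_neg (by omega)] at h
  have h1 : (q : ℤ) ∣ x ^ 2 - s := by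
    obtain ⟨e, rfl⟩ := hqd
    exact ⟨e * y ^ 2, by rw [← h]; push_cast; ring⟩
  have h2 := jacobiSym_ne_neg_one_of_dvd h1
  -- Norm `-1` would make `-1` a square modulo `q`. With norm `1` and `y` odd, `x² = 1 + d y² ≡ 3
  -- mod 4`.
  rcases hs with rfl | rfl
  · by_contra hy
    rw [Int.not_even_iff_odd] at hy
    obtain ⟨k, rfl⟩ := hy
    obtain ⟨j, hj⟩ : ∃ j : ℤ, (d : ℤ) = 4 * j + 2 := ⟨d / 4, by omega⟩
    rw [hj] at h
    have h3 : x ^ 2 = 4 * (4 * j * (k ^ 2 + k) + j + 2 * (k ^ 2 + k)) + 3 := by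
      linear_combination h
    obtain ⟨m, rfl | rfl⟩ := x.even_or_odd'
    · rw [show (2 * m) ^ 2 = 4 * m ^ 2 by ring] at h3
      omega
    · rw [show (2 * m + 1) ^ 2 = 4 * (m ^ 2 + m) + 1 by ring] at h3
      omega
  · exact absurd (jacobiSym_neg_one_of_mod_four_eq_three hq4) h2

theorem exists_prime_dvd_not_dvd (hd : Squarefree d) {y : ℕ} (h : ¬ d ∣ y) :
    ∃ ℓ : ℕ, ℓ.Prime ∧ ℓ ∣ d ∧ ¬ ℓ ∣ y := by
  by_contra! hcon
  apply h
  rw [← Nat.prod_primeFactors_of_squarefree hd]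
  exact Finset.prod_primes_dvd y (fun p hp => (Nat.prime_of_mem_primeFactors hp).prime)
    (fun p hp => hcon p (Nat.prime_of_mem_primeFactors hp) (Nat.dvd_of_mem_primeFactors hp))

/-- If `d` divides the coefficient `y` of the fundamental unit, and the prime ideal above `2` is
principal in case `d ≡ 3 mod 4`, there are no unusual conductors. -/
theorem unusualConductors_eq_empty (hd2 : 2 ≤ d) (hd : Squarefree d) {ε : (maxOrder d)ˣ}
    (hfund : IsFundamentalUnit ε) {x y : ℤ} (hε : (ε : maxOrder d) = x + y * om d)
    (hdy : (d : ℤ) ∣ y)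
    (h3 : d % 4 = 3 → ∃ a b s : ℤ, (s = 1 ∨ s = -1) ∧ a ^ 2 - d * b ^ 2 = s * 2) :
    unusualConductors d = ∅ := by
  rw [Set.eq_empty_iff_forall_notMem]
  rintro f ⟨-, hf, ⟨p, hp, hpf⟩, -, hcl, h2, hne⟩
  obtain ⟨hpp, hpd⟩ := isRamified_iff.mp hp
  by_cases hpd' : p ∣ d
  · have hpy : (p : ℤ) ∣ y := (Int.natCast_dvd_natCast.mpr hpd').trans hdy
    exact orderClassNumber_ne hd2 hd hf hpp hpd' hpf
      (units_mem_order hd2 hd hpp hfund hε hpy) (by omega) hcl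
  · have hd1 : d % 4 ≠ 1 := by
      intro h
      rw [disc, if_pos h] at hpd
      exact hpd' (by exact_mod_cast hpd)
    have hdisc : disc d = 4 * d := if_neg hd1
    rw [hdisc] at hpd
    have hp2 : p = 2 := by
      rcases (Nat.prime_iff_prime_int.mp hpp).dvd_or_dvd hpd with h | h
      · have h7 : p ∣ 2 ^ 2 := by exact_mod_cast h
        exact (Nat.prime_dvd_prime_iff_eq hpp Nat.prime_two).mp (hpp.dvd_of_dvd_pow h7)
      · exact absurd (by exact_mod_cast h) hpd'
    subst hp2
    obtain ⟨a, b, s, hs, hab⟩ := h3 (by omega)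
    refine hne 2 hp hpf a b ?_
    rw [hdisc, show (4 * (d : ℤ) / (2 : ℕ)) = 2 * d by push_cast; omega]
    rw [show ((2 : ℕ) : ℤ) * a ^ 2 - 2 * d * b ^ 2 = 4 * s by push_cast; linear_combination 2 * hab]
    rcases hs with rfl | rfl <;> norm_num

end RealQuadratic

/-! ### The two implications. -/

theorem theorem2p5 (d : ℕ) (hd2 : 2 ≤ d) (hd : Squarefree d)
    (ε : (RealQuadratic.maxOrder d)ˣ) (hε : RealQuadratic.IsFundamentalUnit ε)
    (x y : ℕ)
    (hxy : RealQuadratic.toReal (ε : RealQuadratic.maxOrder d)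
      = (x : ℝ) + (y : ℝ) * RealQuadratic.omega d)
    (hh : RealQuadratic.classNumber d = 2)
    (hcases :
      (∃ p q : ℕ, p.Prime ∧ q.Prime ∧ p ≠ q ∧ p % 4 = 1 ∧ q % 4 = 1 ∧ d = p * q ∧
        Algebra.norm ℚ ((ε : RealQuadratic.maxOrder d) : RealQuadratic.quadField d) = -1) ∨
      (∃ p q : ℕ, p.Prime ∧ q.Prime ∧ p % 8 = 1 ∧ q % 4 = 3 ∧ d = p * q ∧ Odd y) ∨
      (∃ p q : ℕ, p.Prime ∧ q.Prime ∧ p ≠ q ∧ p % 8 = 3 ∧ q % 8 = 3 ∧ d = 2 * p * q) ∨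
      (∃ p q : ℕ, p.Prime ∧ q.Prime ∧ p % 8 = 1 ∧ q % 4 = 3 ∧
        RealQuadratic.kronecker (p : ℤ) q = -1 ∧ d = 2 * p * q)) :
    RealQuadratic.unusualConductors d = ∅ ↔ d ∣ y := by
  open RealQuadratic in
  have hcoord : (ε : maxOrder d) = (x : ℤ) + (y : ℤ) * om d := by
    apply toRealHom_injective
    rw [toRealHom_apply, hxy, map_add, map_mul, toRealHom_om]
    simp
  constructor
  · intro hempty
    by_contra hdy
    obtain ⟨ℓ, hℓ, hℓd, hℓy⟩ := exists_prime_dvd_not_dvd hd hdy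
    have hmem := mem_unusualConductors hℓ hℓd (orderClassNumber_eq_classNumber hd2 hd hℓ hℓd hcoord
      (by exact_mod_cast hℓy)) hh
    rw [hempty] at hmem
    refine hmem fun a b => ?_
    rcases hcases with ⟨p, q, hp, hq, hpq, hp4, hq4, hdpq, hN⟩ |
      ⟨p, q, hp, hq, hp8, hq4, hdpq, -⟩ | ⟨p, q, hp, hq, hpq, hp8, hq8, hdpq⟩ |
      ⟨p, q, hp, hq, hp8, hq4, hk, hdpq⟩
    · have hℓpq := hdpq ▸ hℓd
      rcases hℓ.dvd_mul.mp hℓpq with h | h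
      · obtain rfl := (Nat.prime_dvd_prime_iff_eq hℓ hp).mp h
        exact abs_ne_four_of_norm_eq_neg_one hd2 hd hε hN hp hq hpq hp4 hq4 hdpq a b
      · obtain rfl := (Nat.prime_dvd_prime_iff_eq hℓ hq).mp h
        exact abs_ne_four_of_norm_eq_neg_one hd2 hd hε hN hq hp hpq.symm hq4 hp4
          (hdpq.trans (mul_comm _ _)) a b
    · have hpq : p ≠ q := by rintro rfl; omega
      have htwo := exists_sq_sub_mul_sq_eq_two hd2 hd hh hp hq hp8 hq4 hdpq
      have hd4 : d % 4 ≠ 1 := by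
        rw [hdpq, Nat.mul_mod, hq4, show p % 4 = 1 by omega]; norm_num
      have hℓpq := hdpq ▸ hℓd
      rcases hℓ.dvd_mul.mp hℓpq with h | h
      · obtain rfl := (Nat.prime_dvd_prime_iff_eq hℓ hp).mp h
        exact abs_ne_four_of_sq_sub_mul_sq hd2 hd hε hp hq (by rintro rfl; omega)
          (by rintro rfl; omega) hpq hdpq hd4 htwo a b
      · obtain rfl := (Nat.prime_dvd_prime_iff_eq hℓ hq).mp h
        exact abs_ne_four_of_sq_sub_mul_sq hd2 hd hε hq hp (by rintro rfl; omega)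
          (by rintro rfl; omega) hpq.symm (hdpq.trans (mul_comm _ _)) hd4 htwo a b
    -- For `d = 2pq` the coefficient `y` is even, so `ℓ` is `p` or `q`.
    all_goals
      intro habs
      have hd4 : d % 4 = 2 := by
        have h1 : p * q % 2 = 1 := by
          rw [Nat.mul_mod, show p % 2 = 1 by omega, show q % 2 = 1 by omega]
        rw [mul_assoc] at hdpq
        omega
      have hy2 : 2 ∣ y := by
        have := even_of_unit hd2 hd hcoord hd4 (q := q) (by omega) (hdpq ▸ dvd_mul_left q (2 * p))
        exact_mod_cast this.two_dvd
      have hℓ2 : ℓ ≠ 2 := by rintro rfl; exact hℓy hy2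
      have hℓpq : ℓ = p ∨ ℓ = q := by
        rw [hdpq, mul_assoc] at hℓd
        rcases hℓ.dvd_mul.mp hℓd with h | h
        · exact absurd ((Nat.prime_dvd_prime_iff_eq hℓ Nat.prime_two).mp h) hℓ2
        · exact (hℓ.dvd_mul.mp h).imp (Nat.prime_dvd_prime_iff_eq hℓ hp).mp
            (Nat.prime_dvd_prime_iff_eq hℓ hq).mp
    · rcases hℓpq with rfl | rfl
      · obtain ⟨a, s, hs, h⟩ := exists_of_abs_eq_four hℓ hℓ2 (e := 2 * q)
          (hdpq.trans (by ring)) (by omega) habs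
        exact mul_sq_sub_ne_of_mod_eight_eq_three hp hq hpq hp8 hq8 a b s hs h
      · obtain ⟨a, s, hs, h⟩ := exists_of_abs_eq_four hℓ hℓ2 (e := 2 * p)
          (hdpq.trans (by ring)) (by omega) habs
        exact mul_sq_sub_ne_of_mod_eight_eq_three hq hp hpq.symm hq8 hp8 a b s hs h
    -- Reciprocity turns the symbol into `J(q | p) = -1`; both choices of `ℓ` are then excluded
    -- modulo `p`.
    · rw [kronecker, if_neg (by rintro rfl; omega),
        jacobiSym.quadratic_reciprocity_one_mod_four (by omega) (Nat.odd_iff.mpr (by omega))] at hk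
      obtain ⟨hneg, htwo⟩ := jacobiSym_of_mod_eight_eq_one hp8
      rcases hℓpq with rfl | rfl
      · obtain ⟨a, s, hs, h⟩ := exists_of_abs_eq_four hℓ hℓ2 (e := 2 * q)
          (hdpq.trans (by ring)) (by omega) habs
        have hJ : jacobiSym (-1 * 2 * q) ℓ = -1 := by
          rw [jacobiSym.mul_left, jacobiSym.mul_left, hneg, htwo, hk]; norm_num
        refine not_dvd_mul_sq_sub_of_mod_eight_eq_one hp8 hJ hs (x := b) ⟨-a ^ 2, ?_⟩
        rw [← h]; push_cast; ring
      · obtain ⟨a, s, hs, h⟩ := exists_of_abs_eq_four hℓ hℓ2 (e := 2 * p)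
          (hdpq.trans (by ring)) (by omega) habs
        refine not_dvd_mul_sq_sub_of_mod_eight_eq_one hp8 hk hs (x := a) ⟨2 * b ^ 2, ?_⟩
        rw [← h]; push_cast; ring
  · intro hdy
    -- Only case (b) allows `d ≡ 3 mod 4`.
    refine unusualConductors_eq_empty hd2 hd hε hcoord (by exact_mod_cast hdy) fun hd4 => ?_
    rcases hcases with ⟨p, q, -, -, -, hp4, hq4, hdpq, -⟩ |
      ⟨p, q, hp, hq, hp8, hq4, hdpq, -⟩ | ⟨p, q, -, -, -, -, -, hdpq⟩ |
      ⟨p, q, -, -, -, -, -, hdpq⟩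
    · rw [hdpq, Nat.mul_mod, hp4, hq4] at hd4
      omega
    · exact exists_sq_sub_mul_sq_eq_two hd2 hd hh hp hq hp8 hq4 hdpq
    · rw [mul_assoc] at hdpq
      omega
    · rw [mul_assoc] at hdpq
      omega
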